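/- Let $(X,d)$ be a locally compact separable metric space, $m$ a finite Borel measure on $X$ with $m(U)>0$ for every nonempty open $U\subset X$, and $(\mathcal E,\mathcal D(\mathcal E))$ a symmetric Dirichlet form on $L^2(X,m)$ (a densely defined, symmetric, nonnegative definite, closed bilinear form with the Markov property), with $\mathcal E_1(f,g)=\mathcal E(f,g)+\langle f,g\rangle_{L^2(X,m)}$. Assume that: * $\mathcal E$ is strongly local: $\mathcal E(f,g)=0$ for all $f,g\in C_c(X)\cap\mathcal D(\mathcal E)$ such that $g$ is constant on a neighborhood of $\operatorname{supp} f$; * $\mathcal E$ admits a carré du champ: for $f,g\in C_c(X)\cap\mathcal D(\mathcal E)$ there is $\Gamma(f,g)\in L^1(X,m)$ with $\frac12\{\mathcal E(fh,g)+\mathcal E(gh,f)-\mathcal E(fg,h)\}=\int_X h\,\Gamma(f,g)\,dm$ for all $h\in C_c(X)\cap\mathcal D(\mathcal E)$; write $\Gamma(f)=\Gamma(f,f)$; * $\mathcal A\subset C_c(X)\cap\mathcal D(\mathcal E)$ is an algebra that is uniformly dense in $C_c(X)$ and $\mathcal E_1$-dense in $\mathcal D(\mathcal E)$, and $\Gamma(f,g)\in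 L^\infty(X,m)$ for all $f,g\in\mathcal A$. Let $(\mathcal H_x)_{x\in X}$ be a measurable field of real Hilbert spaces and, for $f\in\mathcal A$, let $\partial f=(\partial_xf)_{x\in X}$ be a measurable section, such that $\langle\partial_xf,\partial_xg\rangle_{\mathcal H_x}=\Gamma(f,g)(x)$ for $m$-a.e. $x$ and all $f,g\in\mathcal A$, and such that the finite sums of sections $b\,\partial a$, $a,b\in\mathcal A$, are dense in $L^2(X,m,(\mathcal H_x)_{x\in X})$. (Thus the direct integral of the $\mathcal H_x$ is the space of generalized $L^2$-vector fields of $\mathcal E$.) Let $1<p<\infty$. If $p<2$, assume moreover that there is a linear space $\mathcal A_{\mathcal L}$ contained in the domain of the generator $\mathcal L$ of $\mathcal E$, $\mathcal E_1$-dense in $\mathcal D(\mathcal E)$, with $\Gamma(f)\in L^\infty(X,m)$ and $\mathcal Lf\in L^\infty(X,m)$ for all $f\in\mathcal A_{\mathcal L}$ (here $\Gamma(f)\in L^1(X,m)$ is defined by approximation of $f$ in $\mathcal E_1$ by elements of $\mathcal A$). For $f\in\mathcal A$ put $\mathcal E^{(p)}(f)=\int_X\Gamma(f)^{p/2}\,dm$.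 For open $\Omega\subset X$, let $H_0^{1,p}(\Omega,m)$ be the space of all $u\in L^p(X,m)$ that are $L^p$-limits of sequences $(\varphi_n)_n\subset\mathcal A$ with $\operatorname{supp}\varphi_n\subset\Omega$ that are Cauchy in the seminorm $\mathcal E^{(p)}(\cdot)^{1/p}$. For $u\in H_0^{1,p}(X,m)$ put $\mathcal E^{(p)}(u)=\lim_n\mathcal E^{(p)}(\varphi_n)$ for such a sequence in $\mathcal A$ (with $\Omega=X$), and let $\partial u=(\partial_xu)_{x\in X}$ be the limit of $\partial\varphi_n$ in $L^p(X,m,(\mathcal H_x)_{x\in X})$. Let $\Omega\subset X$ be open and assume that the Poincaré inequality $$\|u\|_{L^p(\Omega,m)}^p\le c\,\mathcal E^{(p)}(u),\qquad u\in H_0^{1,p}(\Omega,m),$$ holds with some constant $c>0$. Let $f_x:\mathcal H_x\to\mathbb R$, $x\in X$, be such that 1. for every $v\in L^p(X,m,(\mathcal H_x)_{x\in X})$ the function $x\mapsto f_x(v_x)$ is $m$-measurable (that is, $m$-a.e. equal to a Borel function); 2. $f_x$ is lower semicontinuous and convex for every $x\in X$; 3. there are $a\in L^1(X,m)$ and $b>0$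 such that for every $v\in L^p(X,m,(\mathcal H_x)_{x\in X})$ one has $f_x(v_x)\ge -a(x)+b\|v_x\|_{\mathcal H_x}^p$ for $m$-a.e. $x\in X$. Then for every $g\in H_0^{1,p}(X,m)$ the functional $I[u]=\int_X f_x(\partial_xu)\,m(dx)\in(-\infty,+\infty]$ attains its infimum on $g+H_0^{1,p}(\Omega,m)$: there is $u_0\in g+H_0^{1,p}(\Omega,m)$ with $$I[u_0]=\inf_{u\in g+H_0^{1,p}(\Omega,m)}I[u].$$ -/

import Mathlib

open MeasureTheory Filter Topology
open scoped ENNReal CompactlySupported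

noncomputable section

/-- The class in `L²(X, m)` of a continuous compactly supported function. -/
def ccToL2 {X : Type*} [MetricSpace X] [MeasurableSpace X] [BorelSpace X]
    (m : Measure X) [IsFiniteMeasure m] (f : C_c(X, ℝ)) : Lp ℝ 2 m :=
  (f.continuous.memLp_of_hasCompactSupport (μ := m) (p := 2) f.hasCompactSupport).toLp f

/-- A symmetric Dirichlet form on `L²(X, m)`: a densely defined, symmetric, nonnegative definite
bilinear form that is closed and has the Markov property. -/
structure DirichletForm {X : Type*} [MeasurableSpace X] (m : Measure X) where
  /-- the domain `D(E)` -/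
  domain : Submodule ℝ (Lp ℝ 2 m)
  /-- the bilinear form on its domain -/
  form : domain →ₗ[ℝ] domain →ₗ[ℝ] ℝ
  dense_domain : Dense (domain : Set (Lp ℝ 2 m))
  symm : ∀ f g : domain, form f g = form g f
  nonneg : ∀ f : domain, 0 ≤ form f f
  /-- closedness: `D(E)` with `E₁(f, g) = E(f, g) + ⟨f, g⟩` is complete -/
  closed : ∀ u : ℕ → domain,
    (∀ ε : ℝ, 0 < ε → ∃ N : ℕ, ∀ i ≥ N, ∀ j ≥ N,
      form (u i - u j) (u i - u j) + ‖u i - u j‖ ^ 2 < ε) →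
    ∃ v : domain,
      Tendsto (fun n => form (u n - v) (u n - v) + ‖u n - v‖ ^ 2) atTop (𝓝 0)
  /-- Markov property: `(0 ∨ f) ∧ 1` is in the domain and has no larger energy -/
  markov : ∀ f : domain, ∃ g : domain,
    ((g : Lp ℝ 2 m) =ᵐ[m] fun x => min (max 0 ((f : Lp ℝ 2 m) x)) 1) ∧ form g g ≤ form f f

namespace DirichletForm

section

variable {X : Type*} [MetricSpace X] [MeasurableSpace X] [BorelSpace X]
  {m : Measure X} [IsFiniteMeasure m] (E : DirichletForm m)

/-- The set `C_c(X) ∩ D(E)`. -/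
def ccDomain : Set C_c(X, ℝ) := {f | ccToL2 m f ∈ E.domain}

open Classical in
/-- The value `E(f, g)` for `f, g ∈ C_c(X) ∩ D(E)` (and `0` for all other pairs). Since
`C_c(X) ∩ D(E)` is an algebra, products of its elements are never sent to the default value. -/
def val (f g : C_c(X, ℝ)) : ℝ :=
  if h : ccToL2 m f ∈ E.domain ∧ ccToL2 m g ∈ E.domain then
    E.form ⟨ccToL2 m f, h.1⟩ ⟨ccToL2 m g, h.2⟩
  else 0

/-- A core: a subset of `C_c(X) ∩ D(E)` that is uniformly dense in `C_c(X)` and dense in `D(E)`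
with respect to `E₁`. A form that possesses a core is regular. -/
structure IsCore (A : Set C_c(X, ℝ)) : Prop where
  subset_domain : ∀ f ∈ A, ccToL2 m f ∈ E.domain
  uniformly_dense : ∀ φ : C_c(X, ℝ), ∀ ε : ℝ, 0 < ε → ∃ f ∈ A, ∀ x, |f x - φ x| < ε
  energy_dense : ∀ u : E.domain, ∀ ε : ℝ, 0 < ε →
    ∃ f : E.domain, (∃ φ ∈ A, ccToL2 m φ = (f : Lp ℝ 2 m)) ∧
      E.form (f - u) (f - u) + ‖f - u‖ ^ 2 < ε

/-- Strong locality: `E(f, g) = 0` for `f, g ∈ C_c(X) ∩ D(E)` whenever `g` is constant on a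
neighborhood of the support of `f`. -/
def IsStronglyLocal : Prop :=
  ∀ f ∈ E.ccDomain, ∀ g ∈ E.ccDomain,
    (∃ U : Set X, IsOpen U ∧ tsupport f ⊆ U ∧ ∃ c : ℝ, ∀ x ∈ U, g x = c) → E.val f g = 0

/-- `γ ∈ L¹(X, m)` is the energy density `Γ(f, g)`. -/
def IsCarre (f g : C_c(X, ℝ)) (γ : X → ℝ) : Prop :=
  Integrable γ m ∧ ∀ h ∈ E.ccDomain,
    (1 / 2 : ℝ) * (E.val (f * h) g + E.val (g * h) f - E.val (f * g) h) = ∫ x, h x * γ x ∂m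

/-- The form admits a carré du champ. -/
def AdmitsCarre : Prop :=
  ∀ f ∈ E.ccDomain, ∀ g ∈ E.ccDomain, ∃ γ : X → ℝ, E.IsCarre f g γ

open Classical in
/-- The energy density `Γ(f, g)`, `f, g ∈ C_c(X) ∩ D(E)` (determined up to `m`-null sets). -/
def Gam (f g : C_c(X, ℝ)) : X → ℝ :=
  if h : ∃ γ : X → ℝ, E.IsCarre f g γ then h.choose else 0

/-- Standing assumption on the form and the algebra `A`: strong locality, existence of a carré du
champ, `A` is an algebra and a core, and the energy densities of elements of `A` are bounded. -/
structure BasicAssumption (A : NonUnitalSubalgebra ℝ C_c(X, ℝ)) : Prop where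
  stronglyLocal : E.IsStronglyLocal
  admitsCarre : E.AdmitsCarre
  isCore : E.IsCore (A : Set C_c(X, ℝ))
  bounded : ∀ f ∈ A, ∀ g ∈ A, MemLp (E.Gam f g) ∞ m

/-- `f ∈ D(L)` and `w = L f`, for `L` the generator of the form: `E(f, g) = -⟨L f, g⟩` for all
`g ∈ D(E)`. -/
def IsGenerator (f : E.domain) (w : Lp ℝ 2 m) : Prop :=
  ∀ g : E.domain, E.form f g = - inner ℝ w (g : Lp ℝ 2 m)

/-- `γ ∈ L¹(X, m)` is the energy density `Γ(f)` of `f ∈ D(E)`, obtained by approximation: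
there are `φₙ ∈ A` with `φₙ → f` in `E₁` and `Γ(φₙ) → γ` in `L¹(X, m)`. -/
def IsEnergyDensity (A : NonUnitalSubalgebra ℝ C_c(X, ℝ)) (f : E.domain) (γ : X → ℝ) : Prop :=
  Integrable γ m ∧ ∃ (φ : ℕ → A) (u : ℕ → E.domain),
    (∀ n, ccToL2 m (φ n : C_c(X, ℝ)) = (u n : Lp ℝ 2 m)) ∧
    Tendsto (fun n => E.form (u n - f) (u n - f) + ‖u n - f‖ ^ 2) atTop (𝓝 0) ∧
    Tendsto (fun n => ∫ x, |E.Gam (φ n) (φ n) x - γ x| ∂m) atTop (𝓝 0)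

/-- Additional assumption: there is a linear space `AL ⊆ D(L)`, dense in `D(E)` (with respect to
`E₁`), such that `Γ(f)` and `L f` are bounded for every `f ∈ AL`. -/
def GeneratorAssumption (A : NonUnitalSubalgebra ℝ C_c(X, ℝ)) : Prop :=
  ∃ AL : Submodule ℝ E.domain,
    (∀ f ∈ AL, (∃ w : Lp ℝ 2 m, E.IsGenerator f w ∧ MemLp w ∞ m) ∧
      ∃ γ : X → ℝ, E.IsEnergyDensity A f γ ∧ MemLp γ ∞ m) ∧
    ∀ u : E.domain, ∀ ε : ℝ, 0 < ε →
      ∃ f ∈ AL, E.form (f - u) (f - u) + ‖f - u‖ ^ 2 < ε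

/-- The `p`-energy `∫ Γ(f)^{p/2} dm` of `f ∈ A`. -/
def pEnergy (p : ℝ) (f : C_c(X, ℝ)) : ℝ := ∫ x, (E.Gam f f x) ^ (p / 2) ∂m

/-- `(φₙ)` is Cauchy in the seminorm `f ↦ E^{(p)}(f)^{1/p}` and converges to `u` in
`L^p(X, m)`. -/
def Approximates (p : ℝ) (φ : ℕ → C_c(X, ℝ)) (u : Lp ℝ (ENNReal.ofReal p) m) : Prop :=
  (∀ ε : ℝ, 0 < ε → ∃ N : ℕ, ∀ i ≥ N, ∀ j ≥ N, E.pEnergy p (φ i - φ j) ^ (1 / p) < ε) ∧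
  Tendsto (fun n => eLpNorm (fun x => φ n x - u x) (ENNReal.ofReal p) m) atTop (𝓝 0)

/-- The Sobolev space `H₀^{1,p}(Ω, m)`: the completion of the elements of `A` supported in `Ω`.
For `Ω = X` this is `H₀^{1,p}(X, m)`. -/
def sobolev (A : NonUnitalSubalgebra ℝ C_c(X, ℝ)) (p : ℝ) (Ω : Set X) :
    Set (Lp ℝ (ENNReal.ofReal p) m) :=
  {u | ∃ φ : ℕ → C_c(X, ℝ), (∀ n, φ n ∈ A ∧ tsupport (φ n) ⊆ Ω) ∧ E.Approximates p φ u}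

open Classical in
/-- The `p`-energy `E^{(p)}(u) = lim E^{(p)}(φₙ)` of `u ∈ H₀^{1,p}(X, m)`, where `(φₙ) ⊆ A`
approximates `u`. -/
def sobolevEnergy (A : NonUnitalSubalgebra ℝ C_c(X, ℝ)) (p : ℝ)
    (u : Lp ℝ (ENNReal.ofReal p) m) : ℝ :=
  if h : ∃ e : ℝ, ∃ φ : ℕ → C_c(X, ℝ), (∀ n, φ n ∈ A) ∧ E.Approximates p φ u ∧
      Tendsto (fun n => E.pEnergy p (φ n)) atTop (𝓝 e)
  then h.choose else 0

/-- The Poincaré inequality `‖u‖_{L^p(Ω)}^p ≤ c E^{(p)}(u)` on `H₀^{1,p}(Ω, m)`. -/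
def Poincare (A : NonUnitalSubalgebra ℝ C_c(X, ℝ)) (p : ℝ) (Ω : Set X) : Prop :=
  ∃ c : ℝ, 0 < c ∧ ∀ u ∈ E.sobolev A p Ω, ∫ x in Ω, |u x| ^ p ∂m ≤ c * E.sobolevEnergy A p u

/-- The class `g + H₀^{1,p}(Ω, m)` of elements of `H₀^{1,p}(X, m)`. -/
def affineClass (A : NonUnitalSubalgebra ℝ C_c(X, ℝ)) (p : ℝ) (Ω : Set X)
    (g : Lp ℝ (ENNReal.ofReal p) m) : Set (Lp ℝ (ENNReal.ofReal p) m) :=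
  {u | u ∈ E.sobolev A p Set.univ ∧ ∃ φ ∈ E.sobolev A p Ω, u = g + φ}

end

end DirichletForm

/-- A measurable field of (real) Hilbert spaces on the fibers `H x`: a linear space of measurable
sections that is saturated (i) and countably generated in the fibers (ii). -/
structure MeasurableHilbertField (X : Type*) [MeasurableSpace X] (H : X → Type*)
    [∀ x, NormedAddCommGroup (H x)] [∀ x, InnerProductSpace ℝ (H x)]
    [∀ x, CompleteSpace (H x)] where
  /-- the measurable sections -/
  sections : Submodule ℝ (∀ x, H x)
  mem_iff : ∀ ξ : ∀ x, H x,
    ξ ∈ sections ↔ ∀ η ∈ sections, Measurable fun x => inner ℝ (ξ x) (η x)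
  exists_countable : ∃ ξ : ℕ → ∀ x, H x, (∀ i, ξ i ∈ sections) ∧
    ∀ x, Dense (Submodule.span ℝ (Set.range fun i => ξ i x) : Set (H x))

/-- `v` is (a representative of) an element of `L^q(X, m, (H x))`. -/
def MeasurableHilbertField.IsLpSection {X : Type*} [MeasurableSpace X] {H : X → Type*}
    [∀ x, NormedAddCommGroup (H x)] [∀ x, InnerProductSpace ℝ (H x)]
    [∀ x, CompleteSpace (H x)] (F : MeasurableHilbertField X H) (m : Measure X)
    (q : ℝ≥0∞) (v : ∀ x, H x) : Prop :=
  v ∈ F.sections ∧ MemLp (fun x => ‖v x‖) q m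

/-- The fibers `(H x)` as the measurable field of Hilbert spaces that disintegrates the module `𝓗`
of generalized `L²`-vector fields, together with the derivation `∂ : A → 𝓗`.

The Hilbert space `𝓗` is the one densely spanned by elements `a ⊗ b` (`a, b ∈ A`) with
`⟨a ⊗ b, c ⊗ d⟩ = ∫ b d Γ(a, c) dm`, with `a ⊗ b = b ∂a`. So `a ⊗ b ↦ (b(x) ∂ₓa)ₓ` extends to an
isometric isomorphism of `𝓗` with the direct integral `L²(X, m, (H x))`, with `A` acting
pointwise, exactly if `⟨∂ₓa, ∂ₓc⟩ = Γ(a, c)(x)` for `m`-a.e. `x` and the finite sums of sections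
`b ∂a` are dense in `L²(X, m, (H x))`. These are the two conditions below. -/
structure VectorFieldBundle {X : Type*} [MetricSpace X] [MeasurableSpace X] [BorelSpace X]
    {m : Measure X} [IsFiniteMeasure m] (E : DirichletForm m)
    (A : NonUnitalSubalgebra ℝ C_c(X, ℝ)) (H : X → Type*)
    [∀ x, NormedAddCommGroup (H x)] [∀ x, InnerProductSpace ℝ (H x)]
    [∀ x, CompleteSpace (H x)] extends MeasurableHilbertField X H where
  /-- a representative `x ↦ ∂ₓf` of `∂f`, for `f ∈ A` -/
  grad : A → ∀ x, H x
  grad_mem : ∀ f : A, grad f ∈ sections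
  inner_grad : ∀ f g : A, ∀ᵐ x ∂m, inner ℝ (grad f x) (grad g x) = E.Gam f g x
  dense_span : ∀ v : ∀ x, H x, toMeasurableHilbertField.IsLpSection m 2 v →
    ∀ ε : ℝ, 0 < ε → ∃ (n : ℕ) (a b : Fin n → A),
      eLpNorm (fun x => ‖(∑ i, (b i : C_c(X, ℝ)) x • grad (a i) x) - v x‖) 2 m
        < ENNReal.ofReal ε

/-- The integral, with values in the extended reals, of a function whose negative part has a
finite integral. -/
def extIntegral {X : Type*} [MeasurableSpace X] (m : Measure X) (φ : X → ℝ) : EReal :=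
  ((∫⁻ x, ENNReal.ofReal (φ x) ∂m : ℝ≥0∞) : EReal) -
    ((∫⁻ x, ENNReal.ofReal (-φ x) ∂m : ℝ≥0∞) : EReal)

namespace VectorFieldBundle

section

variable {X : Type*} [MetricSpace X] [MeasurableSpace X] [BorelSpace X]
  {m : Measure X} [IsFiniteMeasure m] {E : DirichletForm m}
  {A : NonUnitalSubalgebra ℝ C_c(X, ℝ)} {H : X → Type*}
  [∀ x, NormedAddCommGroup (H x)] [∀ x, InnerProductSpace ℝ (H x)]
  [∀ x, CompleteSpace (H x)] (B : VectorFieldBundle E A H)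

/-- `v` is a representative of `∂u`, where `∂` is the closure of `∂ : A → L^p(X, m, (H x))`
in `L^p(X, m)`. -/
def IsGradient (p : ℝ) (u : Lp ℝ (ENNReal.ofReal p) m) (v : ∀ x, H x) : Prop :=
  B.toMeasurableHilbertField.IsLpSection m (ENNReal.ofReal p) v ∧
  ∃ φ : ℕ → A,
    Tendsto (fun n => eLpNorm (fun x => (φ n : C_c(X, ℝ)) x - u x) (ENNReal.ofReal p) m)
      atTop (𝓝 0) ∧
    Tendsto (fun n => eLpNorm (fun x => ‖B.grad (φ n) x - v x‖) (ENNReal.ofReal p) m)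
      atTop (𝓝 0)

open Classical in
/-- The gradient `x ↦ ∂ₓu` of `u ∈ H₀^{1,p}(X, m)` (determined up to `m`-null sets). -/
def gradient (p : ℝ) (u : Lp ℝ (ENNReal.ofReal p) m) : ∀ x, H x :=
  if h : ∃ v : ∀ x, H x, B.IsGradient p u v then h.choose else 0

/-- The functional `I[u] = ∫ f_x(∂ₓu) m(dx)`. -/
def functional (p : ℝ) (f : ∀ x, H x → ℝ) (u : Lp ℝ (ENNReal.ofReal p) m) : EReal :=
  extIntegral m fun x => f x (B.gradient p u x)

end

end VectorFieldBundle

end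

/-!
The functional is minimized by the direct method, with uniform convexity of the space of `L^p`
sections in place of weak compactness.

**Gradients.** Testing against the core determines the energy densities `Γ(f, g)`
(`DirichletForm.ae_eq_zero_of_forall_integral_core`), so they are bilinear almost everywhere and
the derivation `∂` on the core is linear almost everywhere. Strong locality and cutoff functions
give `E(f, f) = ∫ Γ(f, f) dm` (`DirichletForm.form_eq_integral_gam`), so that energy convergence is
`L²` convergence of gradients. The space of `L^p` sections is complete
(`MeasurableHilbertField.exists_tendsto_secDist`): a fast subsequence converges in almost every
fiber, and measurable sections are closed under pointwise limits. Hence Sobolev functions have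
gradients, and these are unique because `∂` is closable (`VectorFieldBundle.grad_closable`).
For `p ≥ 2` closability is inherited from the closedness of the form in `L²`. For `p < 2`, let
`gₙ → 0` with `∂gₙ → v`. If `u` lies in the generator domain and `Γ(u)`, `L u` are bounded, the
polarized definition of `Γ` yields the integration by parts
`∫ k ⟨∂gₙ, ∂u⟩ = -∫ gₙ (k L u + ⟨∂k, ∂u⟩)` for `k` in the core, whose right-hand side tends to `0`;
thus `⟨v, ∂u⟩ = 0`. By density `v` is orthogonal to all gradients of core elements, and so it
vanishes.

**Minimization.** With `a` the integrable function of the coercivity bound, the functional differs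
by a constant from `J[u] = ∫ (f_x(∂ₓu) + a) dm ∈ [0, ∞]`, which is convex, controls
`N[u] = ∫ ‖∂u‖^p dm`, and is lower semicontinuous along `L^p` convergence of gradients by Fatou's
lemma. A minimizing sequence for `J` can be chosen with `N` almost minimal on the sublevel sets of
`J`; since midpoints stay in the sublevel sets, the midpoint defects of `N` tend to zero
(`exists_minimizing_seq_midpoint`). The pointwise uniform convexity of `‖·‖^p`
(`exists_norm_sub_rpow_le`) then makes the gradients Cauchy in `L^p`
(`MeasurableHilbertField.cauchy_of_midpoint_defect`), and the Poincaré inequality makes the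
functions Cauchy as well. Their limit lies in the affine class
(`VectorFieldBundle.exists_mem_affineClass_of_cauchy`) and is a minimizer.
-/

noncomputable section

/-! ### Uniform convexity of the `p`-th power of a Hilbert norm -/

theorem rpow_defect_pos {p : ℝ} (hp : 1 < p) {t u z : ℝ} (ht : 0 ≤ t) (hu : 0 ≤ u)
    (hz : -(t * u) ≤ z) (hz' : z ≤ t * u) (hne : 2 * z < t ^ 2 + u ^ 2) :
    0 < (t ^ p + u ^ p) / 2 - ((t ^ 2 + u ^ 2 + 2 * z) / 4) ^ (p / 2) := by
  have hs : 0 ≤ (t ^ 2 + u ^ 2 + 2 * z) / 4 := by nlinarith [sq_nonneg (t - u)]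
  have key : (((t + u) / 2) ^ 2) ^ (p / 2) = ((t + u) / 2) ^ p := by
    rw [← Real.rpow_natCast, ← Real.rpow_mul (by positivity)]
    congr 1
    push_cast
    ring
  rcases eq_or_ne t u with h | h
  · subst h
    have h1 : ((t ^ 2 + t ^ 2 + 2 * z) / 4) ^ (p / 2) < (((t + t) / 2) ^ 2) ^ (p / 2) :=
      Real.rpow_lt_rpow hs (by nlinarith) (by linarith)
    rw [key] at h1
    have h2 : (t + t) / 2 = t := by ring
    rw [h2] at h1
    linarith
  · have h1 : ((t ^ 2 + u ^ 2 + 2 * z) / 4) ^ (p / 2) ≤ (((t + u) / 2) ^ 2) ^ (p / 2) :=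
      Real.rpow_le_rpow hs (by nlinarith) (by linarith)
    rw [key] at h1
    have h2 := (strictConvexOn_rpow hp).2 (Set.mem_Ici.2 ht) (Set.mem_Ici.2 hu) h
      (show (0 : ℝ) < 1 / 2 by norm_num) (show (0 : ℝ) < 1 / 2 by norm_num) (by norm_num)
    simp only [smul_eq_mul] at h2
    have h3 : 1 / 2 * t + 1 / 2 * u = (t + u) / 2 := by ring
    rw [h3] at h2
    linarith

/-- A quantitative form of strict convexity, obtained by compactness from the strict inequality
on the unit sphere `t² + u² = 1` and by homogeneity elsewhere. Here `t`, `u`, `z` stand for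
`‖a‖`, `‖b‖` and `⟨a, b⟩`. -/
theorem exists_rpow_defect_ge {p : ℝ} (hp : 1 < p) {ε : ℝ} (hε : 0 < ε) :
    ∃ δ : ℝ, 0 < δ ∧ ∀ t u z : ℝ, 0 ≤ t → 0 ≤ u → -(t * u) ≤ z → z ≤ t * u →
      ε * (t ^ 2 + u ^ 2) ≤ t ^ 2 + u ^ 2 - 2 * z →
      δ * (t ^ 2 + u ^ 2) ^ (p / 2) ≤
        (t ^ p + u ^ p) / 2 - ((t ^ 2 + u ^ 2 + 2 * z) / 4) ^ (p / 2) := by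
  set K : Set (ℝ × ℝ × ℝ) := {y | 0 ≤ y.1 ∧ 0 ≤ y.2.1 ∧ -(y.1 * y.2.1) ≤ y.2.2 ∧
    y.2.2 ≤ y.1 * y.2.1 ∧ y.1 ^ 2 + y.2.1 ^ 2 = 1 ∧ ε ≤ 1 - 2 * y.2.2} with hK
  have hKc : IsCompact K := by
    apply Metric.isCompact_of_isClosed_isBounded
    · simp only [hK, Set.ofPred_and]
      refine (isClosed_le (by fun_prop) (by fun_prop)).inter
        ((isClosed_le (by fun_prop) (by fun_prop)).inter
        ((isClosed_le (by fun_prop) (by fun_prop)).inter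
        ((isClosed_le (by fun_prop) (by fun_prop)).inter
        ((isClosed_eq (by fun_prop) (by fun_prop)).inter
        (isClosed_le (by fun_prop) (by fun_prop))))))
    · refine (Metric.isBounded_Icc (α := ℝ × ℝ × ℝ) (-1, -1, -1) (1, 1, 1)).subset ?_
      rintro ⟨t, u, z⟩ ⟨h1, h2, h3, h4, h5, -⟩
      simp only at h1 h2 h3 h4 h5
      have ht : t ≤ 1 := by nlinarith
      have hu : u ≤ 1 := by nlinarith
      simp only [Set.mem_Icc, Prod.mk_le_mk]
      refine ⟨⟨by linarith, by linarith, by nlinarith⟩, ht, hu, by nlinarith⟩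
  obtain ⟨δ, hδ, hδK⟩ := hKc.exists_forall_le' (a := (0 : ℝ))
    (f := fun y => (y.1 ^ p + y.2.1 ^ p) / 2
      - ((y.1 ^ 2 + y.2.1 ^ 2 + 2 * y.2.2) / 4) ^ (p / 2))
    (by
      have hp0 : 0 ≤ p := by linarith
      have hp2 : 0 ≤ p / 2 := by linarith
      refine Continuous.continuousOn ?_
      refine Continuous.sub (Continuous.div_const (Continuous.add ?_ ?_) _) ?_
      · exact continuous_fst.rpow_const fun _ => Or.inr hp0
      · exact (continuous_fst.comp continuous_snd).rpow_const fun _ => Or.inr hp0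
      · exact Continuous.rpow_const (by fun_prop) fun _ => Or.inr hp2)
    (by
      rintro ⟨t, u, z⟩ ⟨h1, h2, h3, h4, h5, h6⟩
      simp only at h1 h2 h3 h4 h5 h6
      exact rpow_defect_pos hp h1 h2 h3 h4 (by linarith))
  refine ⟨δ, hδ, fun t u z ht hu hz hz' h => ?_⟩
  rcases eq_or_lt_of_le (show 0 ≤ t ^ 2 + u ^ 2 by positivity) with h0 | h0
  · have ht0 : t = 0 := by nlinarith
    have hu0 : u = 0 := by nlinarith
    have hz0 : z = 0 := by subst ht0; linarith
    subst ht0 hu0 hz0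
    simp [Real.zero_rpow (show p ≠ 0 by linarith), Real.zero_rpow (show p / 2 ≠ 0 by linarith)]
  · set r := Real.sqrt (t ^ 2 + u ^ 2) with hr
    have hr0 : 0 < r := Real.sqrt_pos.2 h0
    have hr2 : r ^ 2 = t ^ 2 + u ^ 2 := Real.sq_sqrt h0.le
    have hrp : (r ^ 2) ^ (p / 2) = r ^ p := by
      rw [← Real.rpow_natCast, ← Real.rpow_mul hr0.le]
      congr 1
      push_cast
      ring
    have hmem : ((t / r, u / r, z / r ^ 2) : ℝ × ℝ × ℝ) ∈ K := by
      refine ⟨by positivity, by positivity, ?_, ?_, ?_, ?_⟩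
      · simp only
        rw [div_mul_div_comm, ← pow_two, ← neg_div]
        gcongr
      · simp only
        rw [div_mul_div_comm, ← pow_two]
        gcongr
      · simp only
        rw [div_pow, div_pow, ← add_div, ← hr2]
        field_simp
      · simp only
        rw [← sub_nonneg]
        have : 1 - 2 * (z / r ^ 2) - ε = (t ^ 2 + u ^ 2 - 2 * z - ε * (t ^ 2 + u ^ 2)) / r ^ 2 := by
          rw [← hr2]
          field_simp
        rw [this]
        exact div_nonneg (by linarith) (by positivity)
    have h1 := hδK _ hmem
    simp only at h1
    have e1 : (t / r) ^ p = t ^ p / r ^ p := Real.div_rpow ht hr0.le p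
    have e2 : (u / r) ^ p = u ^ p / r ^ p := Real.div_rpow hu hr0.le p
    have e3 : (((t / r) ^ 2 + (u / r) ^ 2 + 2 * (z / r ^ 2)) / 4) ^ (p / 2)
        = ((t ^ 2 + u ^ 2 + 2 * z) / 4) ^ (p / 2) / r ^ p := by
      rw [← hrp, ← Real.div_rpow (by nlinarith [sq_nonneg (t - u)]) (by positivity)]
      congr 1
      field_simp
    rw [e1, e2, e3] at h1
    have hrp0 : 0 < r ^ p := Real.rpow_pos_of_pos hr0 p
    rw [← hr2, hrp]
    have e4 : (t ^ p / r ^ p + u ^ p / r ^ p) / 2 - ((t ^ 2 + u ^ 2 + 2 * z) / 4) ^ (p / 2) / r ^ p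
        = ((t ^ p + u ^ p) / 2 - ((t ^ 2 + u ^ 2 + 2 * z) / 4) ^ (p / 2)) / r ^ p := by
      field_simp
    rw [e4, le_div_iff₀ hrp0] at h1
    rw [← hr2] at h1
    exact h1

/-- Uniform convexity of `‖·‖ ^ p`, in a form that can be integrated: up to an arbitrarily small
multiple of `‖a‖ ^ p + ‖b‖ ^ p`, the power `‖a - b‖ ^ p` is controlled by the midpoint defect of
`‖·‖ ^ p`. The constant does not depend on the Hilbert space. -/
theorem exists_norm_sub_rpow_le {p : ℝ} (hp : 1 < p) {ε : ℝ} (hε : 0 < ε) :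
    ∃ C : ℝ, 0 < C ∧ ∀ {V : Type*} [NormedAddCommGroup V] [InnerProductSpace ℝ V] (a b : V),
      ‖a - b‖ ^ p ≤ ε * (‖a‖ ^ p + ‖b‖ ^ p) +
        C * ((‖a‖ ^ p + ‖b‖ ^ p) / 2 - ‖(1 / 2 : ℝ) • (a + b)‖ ^ p) := by
  have hp0 : 0 < p := by linarith
  set D : ℝ := 2 ^ (p - 1) with hD
  have hD0 : 0 < D := by positivity
  -- the threshold is chosen so that its `p / 2`-th power times `D` equals `ε`
  set η : ℝ := (ε / D) ^ (2 / p) with hη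
  have hη0 : 0 < η := by positivity
  have hηp : η ^ (p / 2) = ε / D := by
    rw [hη, ← Real.rpow_mul (by positivity)]
    have : 2 / p * (p / 2) = 1 := by field_simp
    rw [this, Real.rpow_one]
  obtain ⟨δ, hδ, hmain⟩ := exists_rpow_defect_ge hp hη0
  refine ⟨2 ^ (p / 2) / δ, by positivity, fun {V} _ _ a b => ?_⟩
  have hsq : ∀ y : ℝ, 0 ≤ y → (y ^ 2) ^ (p / 2) = y ^ p := fun y hy => by
    rw [← Real.rpow_natCast, ← Real.rpow_mul hy]
    congr 1
    push_cast
    ring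
  have hsub : ‖a - b‖ ^ 2 = ‖a‖ ^ 2 + ‖b‖ ^ 2 - 2 * inner ℝ a b := by
    rw [norm_sub_sq_real]; ring
  have hmid : ‖(1 / 2 : ℝ) • (a + b)‖ ^ 2 = (‖a‖ ^ 2 + ‖b‖ ^ 2 + 2 * inner ℝ a b) / 4 := by
    rw [norm_smul, mul_pow, norm_add_sq_real]
    norm_num
    ring
  have hin := abs_le.1 (abs_real_inner_le_norm a b)
  have hsum : (‖a‖ ^ 2 + ‖b‖ ^ 2) ^ (p / 2) ≤ D * (‖a‖ ^ p + ‖b‖ ^ p) := by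
    calc (‖a‖ ^ 2 + ‖b‖ ^ 2) ^ (p / 2) ≤ ((‖a‖ + ‖b‖) ^ 2) ^ (p / 2) := by
          apply Real.rpow_le_rpow (by positivity) _ (by positivity)
          nlinarith [norm_nonneg a, norm_nonneg b, mul_nonneg (norm_nonneg a) (norm_nonneg b)]
      _ = (‖a‖ + ‖b‖) ^ p := hsq _ (by positivity)
      _ ≤ D * (‖a‖ ^ p + ‖b‖ ^ p) := by
          exact_mod_cast NNReal.rpow_add_le_mul_rpow_add_rpow ‖a‖₊ ‖b‖₊ hp.le
  have hdef : 0 ≤ (‖a‖ ^ p + ‖b‖ ^ p) / 2 - ‖(1 / 2 : ℝ) • (a + b)‖ ^ p := by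
    have h1 : ‖(1 / 2 : ℝ) • (a + b)‖ ≤ (‖a‖ + ‖b‖) / 2 := by
      rw [norm_smul]
      have := norm_add_le a b
      norm_num
      linarith
    have h2 : ‖(1 / 2 : ℝ) • (a + b)‖ ^ p ≤ ((‖a‖ + ‖b‖) / 2) ^ p :=
      Real.rpow_le_rpow (norm_nonneg _) h1 hp0.le
    have h3 := (convexOn_rpow hp.le).2 (Set.mem_Ici.2 (norm_nonneg a))
      (Set.mem_Ici.2 (norm_nonneg b)) (show (0 : ℝ) ≤ 1 / 2 by norm_num)
      (show (0 : ℝ) ≤ 1 / 2 by norm_num) (by norm_num)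
    simp only [smul_eq_mul] at h3
    have h4 : 1 / 2 * ‖a‖ + 1 / 2 * ‖b‖ = (‖a‖ + ‖b‖) / 2 := by ring
    rw [h4] at h3
    linarith
  have hC : 0 < 2 ^ (p / 2) / δ := by positivity
  rcases le_or_gt (η * (‖a‖ ^ 2 + ‖b‖ ^ 2)) (‖a - b‖ ^ 2) with h | h
  · have h1 := hmain ‖a‖ ‖b‖ (inner ℝ a b) (norm_nonneg a) (norm_nonneg b) hin.1 hin.2
      (by rw [← hsub]; exact h)
    rw [← hmid, hsq _ (norm_nonneg _)] at h1
    have h2 : ‖a - b‖ ^ p ≤ 2 ^ (p / 2) * (‖a‖ ^ 2 + ‖b‖ ^ 2) ^ (p / 2) := by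
      rw [← hsq _ (norm_nonneg _), ← Real.mul_rpow (by norm_num) (by positivity)]
      apply Real.rpow_le_rpow (by positivity) _ (by positivity)
      nlinarith [sq_nonneg (‖a‖ - ‖b‖)]
    have h3 : 2 ^ (p / 2) * (‖a‖ ^ 2 + ‖b‖ ^ 2) ^ (p / 2) ≤ 2 ^ (p / 2) / δ *
        ((‖a‖ ^ p + ‖b‖ ^ p) / 2 - ‖(1 / 2 : ℝ) • (a + b)‖ ^ p) := by
      rw [div_mul_eq_mul_div, le_div_iff₀ hδ, mul_assoc]
      gcongr
      linarith
    have h4 : 0 ≤ ε * (‖a‖ ^ p + ‖b‖ ^ p) := by positivity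
    linarith
  · have h1 : ‖a - b‖ ^ p ≤ ε * (‖a‖ ^ p + ‖b‖ ^ p) := by
      calc ‖a - b‖ ^ p = (‖a - b‖ ^ 2) ^ (p / 2) := (hsq _ (norm_nonneg _)).symm
        _ ≤ (η * (‖a‖ ^ 2 + ‖b‖ ^ 2)) ^ (p / 2) :=
            Real.rpow_le_rpow (by positivity) h.le (by positivity)
        _ = ε / D * (‖a‖ ^ 2 + ‖b‖ ^ 2) ^ (p / 2) := by
            rw [Real.mul_rpow hη0.le (by positivity), hηp]
        _ ≤ ε / D * (D * (‖a‖ ^ p + ‖b‖ ^ p)) := by gcongr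
        _ = ε * (‖a‖ ^ p + ‖b‖ ^ p) := by field_simp
    have h2 := mul_nonneg hC.le hdef
    linarith

/-! ### Extended integrals and minimizing sequences -/

/-- Adding an integrable minorant turns the extended integral into a lower Lebesgue integral, up
to a finite constant. -/
theorem extIntegral_eq_lintegral_sub {X : Type*} [MeasurableSpace X] {m : Measure X}
    {φ a : X → ℝ} (hφ : AEMeasurable φ m) (ha : Integrable a m) (h : ∀ᵐ x ∂m, -a x ≤ φ x) :
    extIntegral m φ =
      ((∫⁻ x, ENNReal.ofReal (φ x + a x) ∂m : ℝ≥0∞) : EReal) - ((∫ x, a x ∂m : ℝ) : EReal) := by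
  have ham := ha.1.aemeasurable
  set P := ∫⁻ x, ENNReal.ofReal (φ x) ∂m
  set N := ∫⁻ x, ENNReal.ofReal (-φ x) ∂m with hN
  set J := ∫⁻ x, ENNReal.ofReal (φ x + a x) ∂m
  set a₁ := ∫⁻ x, ENNReal.ofReal (a x) ∂m
  set a₂ := ∫⁻ x, ENNReal.ofReal (-a x) ∂m
  have ha₁ : a₁ ≠ ∞ := ha.lintegral_lt_top.ne
  have ha₂ : a₂ ≠ ∞ := ha.neg.lintegral_lt_top.ne
  have hNf : N ≠ ∞ := by
    refine ne_top_of_le_ne_top ha₁ (lintegral_mono_ae ?_)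
    filter_upwards [h] with x hx
    exact ENNReal.ofReal_le_ofReal (by linarith)
  have hsum : P + a₁ = J + N + a₂ := by
    rw [← lintegral_add_left' hφ.ennreal_ofReal, ← lintegral_add_right' _ (by fun_prop),
      ← lintegral_add_right' _ (by fun_prop)]
    refine lintegral_congr_ae ?_
    filter_upwards [h] with x hx
    rcases le_total 0 (φ x) with h1 | h1 <;> rcases le_total 0 (a x) with h2 | h2
    · rw [ENNReal.ofReal_of_nonpos (show -φ x ≤ 0 by linarith),
        ENNReal.ofReal_of_nonpos (show -a x ≤ 0 by linarith), ← ENNReal.ofReal_add h1 h2]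
      simp
    · rw [ENNReal.ofReal_of_nonpos (show -φ x ≤ 0 by linarith), ENNReal.ofReal_of_nonpos h2,
        add_zero, add_zero, ← ENNReal.ofReal_add (by linarith) (by linarith)]
      congr 1
      ring
    · rw [ENNReal.ofReal_of_nonpos h1, ENNReal.ofReal_of_nonpos (show -a x ≤ 0 by linarith),
        add_zero, zero_add, ← ENNReal.ofReal_add (by linarith) (by linarith)]
      congr 1
      ring
    · have h3 : φ x = 0 := by linarith
      have h4 : a x = 0 := by linarith
      simp [h3, h4]
  rw [extIntegral, integral_eq_lintegral_pos_part_sub_lintegral_neg_part ha]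
  change (P : EReal) - (N : EReal) = (J : EReal) - ((a₁.toReal - a₂.toReal : ℝ) : EReal)
  rcases eq_or_ne J ∞ with hJ | hJ
  · have hP : P = ∞ := by
      by_contra hP
      exact (ENNReal.add_ne_top.2 ⟨hP, ha₁⟩) (by rw [hsum, hJ]; simp)
    rw [hJ, hP]
    rw [EReal.coe_ennreal_top, EReal.top_sub_coe,
      ← EReal.coe_toReal (x := (N : EReal)) (by simpa using hNf) (by simp), EReal.top_sub_coe]
  · have hP : P ≠ ∞ := by
      intro hP
      have : J + N + a₂ ≠ ∞ := by simp [hJ, hNf, ha₂]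
      exact this (by rw [← hsum, hP]; simp)
    have e := congrArg ENNReal.toReal hsum
    rw [ENNReal.toReal_add hP ha₁, ENNReal.toReal_add (by simp [hJ, hNf]) ha₂,
      ENNReal.toReal_add hJ hNf] at e
    rw [← EReal.coe_toReal (x := (P : EReal)) (by simpa using hP) (by simp),
      ← EReal.coe_toReal (x := (N : EReal)) (by simpa using hNf) (by simp),
      ← EReal.coe_toReal (x := (J : EReal)) (by simpa using hJ) (by simp)]
    simp only [EReal.toReal_coe_ennreal]
    rw [← EReal.coe_sub, ← EReal.coe_sub]
    congr 1
    linarith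

/-- A substitute for weak compactness. Let `J` be quasiconvex and `N` be bounded on the sublevel
sets of `J`, where convexity refers to an abstract midpoint operation. Choosing the elements of a
minimizing sequence with `N` almost minimal on the sublevel sets of `J` forces the midpoint
defects of `N` to vanish. -/
theorem exists_minimizing_seq_midpoint {α : Type*} (mid : α → α → α) (S : Set α) (J : α → ℝ≥0∞)
    (N : α → ℝ) (hmid : ∀ a ∈ S, ∀ b ∈ S, mid a b ∈ S)
    (hJ : ∀ a ∈ S, ∀ b ∈ S, J (mid a b) ≤ max (J a) (J b)) (hN0 : ∀ a, 0 ≤ N a)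
    (hN : ∀ t : ℝ≥0∞, t ≠ ∞ → ∃ C, ∀ a ∈ S, J a ≤ t → N a ≤ C) (hfin : ∃ a ∈ S, J a ≠ ∞) :
    ∃ v : ℕ → α, (∀ n, v n ∈ S) ∧ Tendsto (fun n => J (v n)) atTop (𝓝 (⨅ a ∈ S, J a)) ∧
      (∃ C, ∀ n, N (v n) ≤ C) ∧
      ∀ ε : ℝ, 0 < ε → ∃ K : ℕ, ∀ i ≥ K, ∀ j ≥ K,
        (N (v i) + N (v j)) / 2 - N (mid (v i) (v j)) < ε := by
  set j₀ := ⨅ a ∈ S, J a with hj₀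
  have hj₀fin : j₀ ≠ ∞ := by
    obtain ⟨a, ha, hJa⟩ := hfin
    exact ne_top_of_le_ne_top hJa (iInf₂_le a ha)
  set t : ℕ → ℝ≥0∞ := fun n => j₀ + (n + 1 : ℝ≥0∞)⁻¹ with ht
  have htfin : ∀ n, t n ≠ ∞ := fun n => by simp [ht, hj₀fin]
  have htanti : Antitone t := fun i j hij => by
    simp only [ht]
    gcongr
  have htt : Tendsto t atTop (𝓝 j₀) := by
    have h1 : Tendsto (fun n : ℕ => ((n + 1 : ℕ) : ℝ≥0∞)⁻¹) atTop (𝓝 0) :=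
      ENNReal.tendsto_inv_nat_nhds_zero.comp (tendsto_add_atTop_nat 1)
    have h2 := (tendsto_const_nhds (x := j₀)).add h1
    simpa [ht] using h2
  set L : ℕ → Set ℝ := fun n => N '' {a | a ∈ S ∧ J a ≤ t n} with hL
  have hLne : ∀ n, (L n).Nonempty := fun n => by
    have : j₀ < t n := ENNReal.lt_add_right hj₀fin (by simp)
    obtain ⟨a, ha⟩ := iInf_lt_iff.1 this
    obtain ⟨ha, hJa⟩ := iInf_lt_iff.1 ha
    exact ⟨N a, a, ⟨ha, hJa.le⟩, rfl⟩
  have hLbdd : ∀ n, BddBelow (L n) := fun n => ⟨0, by rintro _ ⟨a, -, rfl⟩; exact hN0 a⟩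
  set r : ℕ → ℝ := fun n => sInf (L n) with hr
  have hrle : ∀ n a, a ∈ S → J a ≤ t n → r n ≤ N a := fun n a ha hJa =>
    csInf_le (hLbdd n) ⟨a, ⟨ha, hJa⟩, rfl⟩
  have hrmono : Monotone r := fun i j hij => by
    refine csInf_le_csInf (hLbdd i) (hLne j) ?_
    rintro _ ⟨a, ⟨ha, hJa⟩, rfl⟩
    exact ⟨a, ⟨ha, hJa.trans (htanti hij)⟩, rfl⟩
  have hv : ∀ n, ∃ a, (a ∈ S ∧ J a ≤ t n) ∧ N a < r n + 1 / (n + 1) := fun n => by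
    obtain ⟨_, ⟨a, ha, rfl⟩, h⟩ := exists_lt_of_csInf_lt (hLne n)
      (show sInf (L n) < r n + 1 / (n + 1) by
        have : (0 : ℝ) < 1 / (n + 1) := by positivity
        simp only [hr]; linarith)
    exact ⟨a, ha, h⟩
  choose v hv1 hv2 using hv
  obtain ⟨C, hC⟩ := hN (t 0) (htfin 0)
  have hvC : ∀ n, N (v n) ≤ C := fun n =>
    hC _ (hv1 n).1 ((hv1 n).2.trans (htanti (Nat.zero_le n)))
  have hrC : ∀ n, r n ≤ C := fun n => (hrle n _ (hv1 n).1 (hv1 n).2).trans (hvC n)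
  have hrt := tendsto_atTop_ciSup hrmono ⟨C, by rintro _ ⟨n, rfl⟩; exact hrC n⟩
  set R := ⨆ n, r n
  have hrR : ∀ n, r n ≤ R := hrmono.ge_of_tendsto hrt
  refine ⟨v, fun n => (hv1 n).1, ?_, ⟨C, hvC⟩, fun ε hε => ?_⟩
  · exact tendsto_of_tendsto_of_tendsto_of_le_of_le tendsto_const_nhds htt
      (fun n => iInf₂_le _ (hv1 n).1) (fun n => (hv1 n).2)
  · have h1 : ∀ᶠ n in atTop, R - ε / 2 < r n := hrt.eventually (lt_mem_nhds (by linarith))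
    have h2 : ∀ᶠ n : ℕ in atTop, 1 / ((n : ℝ) + 1) < ε / 2 :=
      tendsto_one_div_add_atTop_nhds_zero_nat.eventually (gt_mem_nhds (by linarith))
    obtain ⟨K, hK⟩ := eventually_atTop.1 (h1.and h2)
    refine ⟨K, fun i hi j hj => ?_⟩
    have h3 : r K ≤ N (mid (v i) (v j)) :=
      hrle K _ (hmid _ (hv1 i).1 _ (hv1 j).1)
        ((hJ _ (hv1 i).1 _ (hv1 j).1).trans
          (max_le ((hv1 i).2.trans (htanti hi)) ((hv1 j).2.trans (htanti hj))))
    have := (hK i hi).2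
    have := (hK j hj).2
    have := (hK K le_rfl).1
    have := hv2 i
    have := hv2 j
    have := hrR i
    have := hrR j
    linarith

/-! ### `L^q` norms on finite measure spaces -/

theorem measure_univ_rpow_ne_top {X : Type*} [MeasurableSpace X] (m : Measure X)
    [IsFiniteMeasure m] {q r : ℝ≥0∞} (hq : q ≠ 0) (hqr : q ≤ r) :
    m Set.univ ^ (1 / q.toReal - 1 / r.toReal) ≠ ∞ := by
  refine ENNReal.rpow_ne_top_of_nonneg ?_ (measure_ne_top m _)
  rcases eq_or_ne r ∞ with h | h
  · simp [h]
  · rw [sub_nonneg]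
    exact one_div_le_one_div_of_le (ENNReal.toReal_pos hq (ne_top_of_le_ne_top h hqr))
      (ENNReal.toReal_mono h hqr)

theorem tendsto_eLpNorm_mono_exponent {X : Type*} [MeasurableSpace X] {m : Measure X}
    [IsFiniteMeasure m] {q r : ℝ≥0∞} (hq : q ≠ 0) (hqr : q ≤ r) {φ : ℕ → X → ℝ}
    (hφ : ∀ n, AEStronglyMeasurable (φ n) m)
    (h : Tendsto (fun n => eLpNorm (φ n) r m) atTop (𝓝 0)) :
    Tendsto (fun n => eLpNorm (φ n) q m) atTop (𝓝 0) := by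
  have h1 : Tendsto (fun n => eLpNorm (φ n) r m * m Set.univ ^ (1 / q.toReal - 1 / r.toReal))
      atTop (𝓝 (0 * m Set.univ ^ (1 / q.toReal - 1 / r.toReal))) :=
    ENNReal.Tendsto.mul_const h (Or.inr (measure_univ_rpow_ne_top m hq hqr))
  rw [zero_mul] at h1
  exact tendsto_of_tendsto_of_tendsto_of_le_of_le tendsto_const_nhds h1 (fun _ => bot_le)
    (fun n => eLpNorm_le_eLpNorm_mul_rpow_measure_univ hqr (hφ n))

theorem ae_abs_le_toReal_eLpNorm_top {X : Type*} [MeasurableSpace X] {m : Measure X}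
    {φ : X → ℝ} (hφ : MemLp φ ∞ m) : ∀ᵐ x ∂m, |φ x| ≤ (eLpNorm φ ∞ m).toReal := by
  have h := ae_le_eLpNormEssSup (f := φ) (μ := m)
  rw [← eLpNorm_exponent_top] at h
  filter_upwards [h] with x hx
  rw [← Real.norm_eq_abs, ← toReal_enorm]
  exact ENNReal.toReal_mono hφ.2.ne hx

theorem eLpNorm_ofReal_eq {X : Type*} [MeasurableSpace X] {m : Measure X} {p : ℝ} (hp : 0 < p)
    {φ : X → ℝ} (hφ : MemLp φ (ENNReal.ofReal p) m) :
    eLpNorm φ (ENNReal.ofReal p) m = ENNReal.ofReal ((∫ x, |φ x| ^ p ∂m) ^ (1 / p)) := by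
  rw [hφ.eLpNorm_eq_integral_rpow_norm (by simpa using hp) (by simp),
    ENNReal.toReal_ofReal hp.le, one_div]
  rfl

/-! ### Measurable fields of Hilbert spaces -/

namespace MeasurableHilbertField

section

variable {X : Type*} [MeasurableSpace X] {H : X → Type*} [∀ x, NormedAddCommGroup (H x)]
  {m : Measure X}

/-- The `L^q` distance of two sections of a field of Hilbert spaces. -/
abbrev secDist (m : Measure X) (q : ℝ≥0∞) (v w : ∀ x, H x) : ℝ≥0∞ :=
  eLpNorm (fun x => ‖v x - w x‖) q m

theorem secDist_comm (q : ℝ≥0∞) (v w : ∀ x, H x) : secDist m q v w = secDist m q w v := by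
  simp only [secDist, norm_sub_rev]

theorem secDist_congr {q : ℝ≥0∞} {v v' w w' : ∀ x, H x} (hv : ∀ᵐ x ∂m, v x = v' x)
    (hw : ∀ᵐ x ∂m, w x = w' x) : secDist m q v w = secDist m q v' w' := by
  refine eLpNorm_congr_ae ?_
  filter_upwards [hv, hw] with x h1 h2
  rw [h1, h2]

end

section

variable {X : Type*} [MeasurableSpace X] {H : X → Type*}
  [∀ x, NormedAddCommGroup (H x)] [∀ x, InnerProductSpace ℝ (H x)]
  [∀ x, CompleteSpace (H x)] {F : MeasurableHilbertField X H} {m : Measure X}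

theorem measurable_inner {v w : ∀ x, H x} (hv : v ∈ F.sections) (hw : w ∈ F.sections) :
    Measurable fun x => (inner ℝ (v x) (w x) : ℝ) :=
  (F.mem_iff v).1 hv w hw

theorem measurable_norm {v : ∀ x, H x} (hv : v ∈ F.sections) : Measurable fun x => ‖v x‖ := by
  have h := (measurable_inner hv hv).sqrt
  simpa only [real_inner_self_eq_norm_sq, Real.sqrt_sq (norm_nonneg _)] using h

theorem smul_mem_sections {φ : X → ℝ} (hφ : Measurable φ) {v : ∀ x, H x} (hv : v ∈ F.sections) :
    (fun x => φ x • v x) ∈ F.sections := by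
  rw [F.mem_iff]
  intro η hη
  simp only [real_inner_smul_left]
  exact hφ.mul (measurable_inner hv hη)

theorem mem_sections_of_tendsto {v : ℕ → ∀ x, H x} (hv : ∀ n, v n ∈ F.sections) {w : ∀ x, H x}
    (h : ∀ x, Tendsto (fun n => v n x) atTop (𝓝 (w x))) : w ∈ F.sections := by
  rw [F.mem_iff]
  intro η hη
  refine measurable_of_tendsto_metrizable (fun n => measurable_inner (hv n) hη) ?_
  rw [tendsto_pi_nhds]
  exact fun x => (h x).inner tendsto_const_nhds

theorem aestronglyMeasurable_norm {v : ∀ x, H x} (hv : v ∈ F.sections) :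
    AEStronglyMeasurable (fun x => ‖v x‖) m :=
  (measurable_norm hv).aestronglyMeasurable

theorem aestronglyMeasurable_norm_sub {v w : ∀ x, H x} (hv : v ∈ F.sections)
    (hw : w ∈ F.sections) : AEStronglyMeasurable (fun x => ‖v x - w x‖) m :=
  (measurable_norm (F.sections.sub_mem hv hw)).aestronglyMeasurable

theorem secDist_triangle {q : ℝ≥0∞} (hq : 1 ≤ q) {u v w : ∀ x, H x} (hu : u ∈ F.sections)
    (hv : v ∈ F.sections) (hw : w ∈ F.sections) :
    secDist m q u w ≤ secDist m q u v + secDist m q v w := by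
  refine le_trans (eLpNorm_mono_real
    (g := (fun x => ‖u x - v x‖) + fun x => ‖v x - w x‖) fun x => ?_)
    (eLpNorm_add_le (aestronglyMeasurable_norm_sub hu hv)
      (aestronglyMeasurable_norm_sub hv hw) hq)
  rw [norm_norm]
  exact norm_sub_le_norm_sub_add_norm_sub _ _ _

theorem ae_eq_of_secDist_eq_zero {q : ℝ≥0∞} (hq : q ≠ 0) {v w : ∀ x, H x} (hv : v ∈ F.sections)
    (hw : w ∈ F.sections) (h : secDist m q v w = 0) : ∀ᵐ x ∂m, v x = w x := by
  rw [secDist, eLpNorm_eq_zero_iff (aestronglyMeasurable_norm_sub hv hw) hq] at h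
  filter_upwards [h] with x hx
  exact sub_eq_zero.1 (norm_eq_zero.1 hx)

theorem tendsto_secDist_mono [IsFiniteMeasure m] {q r : ℝ≥0∞} (hq : q ≠ 0) (hqr : q ≤ r)
    {v : ℕ → ∀ x, H x} (hv : ∀ n, v n ∈ F.sections) {w : ∀ x, H x} (hw : w ∈ F.sections)
    (h : Tendsto (fun n => secDist m r (v n) w) atTop (𝓝 0)) :
    Tendsto (fun n => secDist m q (v n) w) atTop (𝓝 0) :=
  tendsto_eLpNorm_mono_exponent hq hqr (fun n => aestronglyMeasurable_norm_sub (hv n) hw) h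

theorem IsLpSection.sub {q : ℝ≥0∞} {v w : ∀ x, H x} (hv : F.IsLpSection m q v)
    (hw : F.IsLpSection m q w) : F.IsLpSection m q (v - w) := by
  have h := F.sections.sub_mem hv.1 hw.1
  refine ⟨h, (hv.2.add hw.2).mono (aestronglyMeasurable_norm h) (ae_of_all _ fun x => ?_)⟩
  simp only [Pi.add_apply, Pi.sub_apply, norm_norm]
  rw [Real.norm_of_nonneg (by positivity)]
  exact norm_sub_le _ _

theorem IsLpSection.add {q : ℝ≥0∞} {v w : ∀ x, H x} (hv : F.IsLpSection m q v)
    (hw : F.IsLpSection m q w) : F.IsLpSection m q (v + w) := by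
  have h := F.sections.add_mem hv.1 hw.1
  refine ⟨h, (hv.2.add hw.2).mono (aestronglyMeasurable_norm h) (ae_of_all _ fun x => ?_)⟩
  simp only [Pi.add_apply, norm_norm]
  rw [Real.norm_of_nonneg (by positivity)]
  exact norm_add_le _ _

theorem IsLpSection.smul {q : ℝ≥0∞} (c : ℝ) {v : ∀ x, H x} (hv : F.IsLpSection m q v) :
    F.IsLpSection m q (c • v) := by
  refine ⟨F.sections.smul_mem c hv.1, ?_⟩
  have h : (fun x => ‖(c • v) x‖) = fun x => ‖c‖ * ‖v x‖ := by
    funext x; simp [norm_smul]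
  rw [h]
  exact hv.2.const_mul _

theorem IsLpSection.memLp_norm_sub {q : ℝ≥0∞} {v w : ∀ x, H x} (hv : F.IsLpSection m q v)
    (hw : F.IsLpSection m q w) : MemLp (fun x => ‖v x - w x‖) q m :=
  (hv.sub hw).2

theorem IsLpSection.mono [IsFiniteMeasure m] {q r : ℝ≥0∞} (hqr : q ≤ r) {v : ∀ x, H x}
    (hv : F.IsLpSection m r v) : F.IsLpSection m q v :=
  ⟨hv.1, hv.2.mono_exponent hqr⟩

theorem isLpSection_of_secDist_lt_top {q : ℝ≥0∞} {v w : ∀ x, H x}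
    (hv : F.IsLpSection m q v) (hw : w ∈ F.sections) (h : secDist m q v w < ∞) :
    F.IsLpSection m q w := by
  refine ⟨hw, (hv.2.add ⟨aestronglyMeasurable_norm_sub hv.1 hw, h⟩).mono
    (aestronglyMeasurable_norm hw) (ae_of_all _ fun x => ?_)⟩
  simp only [Pi.add_apply, norm_norm]
  rw [Real.norm_of_nonneg (by positivity)]
  have := norm_sub_norm_le (w x) (v x)
  rw [norm_sub_rev] at this
  linarith

theorem exists_subseq_tendsto_ae {q : ℝ≥0∞} (hq : q ≠ 0) {v : ℕ → ∀ x, H x}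
    (hv : ∀ n, v n ∈ F.sections) {w : ∀ x, H x} (hw : w ∈ F.sections)
    (h : Tendsto (fun n => secDist m q (v n) w) atTop (𝓝 0)) :
    ∃ ns : ℕ → ℕ, StrictMono ns ∧
      ∀ᵐ x ∂m, Tendsto (fun k => v (ns k) x) atTop (𝓝 (w x)) := by
  have h1 : TendstoInMeasure m (fun n x => ‖v n x - w x‖) atTop fun _ => (0 : ℝ) := by
    have h0 : ∀ n, ((fun x => ‖v n x - w x‖) - fun _ : X => (0 : ℝ)) = fun x => ‖v n x - w x‖ :=
      fun n => funext fun x => sub_zero _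
    have h2 : Tendsto (fun n => eLpNorm ((fun x => ‖v n x - w x‖) - fun _ : X => (0 : ℝ)) q m)
        atTop (𝓝 0) := by
      simp only [h0]
      exact h
    exact tendstoInMeasure_of_tendsto_eLpNorm (f := fun n x => ‖v n x - w x‖) hq
      (fun n => aestronglyMeasurable_norm_sub (hv n) hw) aestronglyMeasurable_const h2
  obtain ⟨ns, hns, hae⟩ := h1.exists_seq_tendsto_ae
  refine ⟨ns, hns, ?_⟩
  filter_upwards [hae] with x hx
  exact tendsto_iff_norm_sub_tendsto_zero.2 hx

/-- A sequence of sections that is Cauchy in `L^q` has a subsequence converging almost everywhere,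
with a measurable limit. -/
theorem exists_subseq_limit [IsFiniteMeasure m] {q : ℝ≥0∞} (hq : 1 ≤ q) {v : ℕ → ∀ x, H x}
    (hv : ∀ n, v n ∈ F.sections)
    (hc : ∀ ε : ℝ≥0∞, 0 < ε → ∃ N, ∀ i ≥ N, ∀ j ≥ N, secDist m q (v i) (v j) < ε) :
    ∃ w ∈ F.sections, ∃ ns : ℕ → ℕ, StrictMono ns ∧
      ∀ᵐ x ∂m, Tendsto (fun k => v (ns k) x) atTop (𝓝 (w x)) := by
  have hev : ∀ n : ℕ, ∃ N, ∀ k ≥ N, ∀ j ≥ k, secDist m q (v k) (v j) < (2 : ℝ≥0∞)⁻¹ ^ n := by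
    intro n
    obtain ⟨N, hN⟩ := hc ((2 : ℝ≥0∞)⁻¹ ^ n) (ENNReal.pow_pos (by simp) n)
    exact ⟨N, fun k hk j hj => hN k hk j (le_trans hk hj)⟩
  obtain ⟨ns, hns, hfast⟩ := extraction_forall_of_eventually' hev
  -- the total variation of the subsequence is integrable, hence finite almost everywhere
  set G : X → ℝ≥0∞ := fun x => ∑' k, ‖v (ns k) x - v (ns (k + 1)) x‖ₑ with hG
  have hmeas : ∀ k, Measurable fun x => ‖v (ns k) x - v (ns (k + 1)) x‖ₑ := fun k => by
    have := (measurable_norm (F.sections.sub_mem (hv (ns k)) (hv (ns (k + 1))))).ennreal_ofReal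
    simpa only [ofReal_norm, Pi.sub_apply] using this
  have hGm : Measurable G := Measurable.tsum hmeas
  set D : ℝ≥0∞ := m Set.univ ^ ((1 : ℝ≥0∞).toReal⁻¹ - q.toReal⁻¹) with hD
  have hDfin : D ≠ ∞ := by
    simpa only [one_div] using measure_univ_rpow_ne_top m one_ne_zero hq
  have hGint : ∫⁻ x, G x ∂m ≠ ∞ := by
    rw [lintegral_tsum fun k => (hmeas k).aemeasurable]
    have hle : ∀ k, ∫⁻ x, ‖v (ns k) x - v (ns (k + 1)) x‖ₑ ∂m ≤ (2 : ℝ≥0∞)⁻¹ ^ k * D := fun k => by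
      have h1 := eLpNorm_le_eLpNorm_mul_rpow_measure_univ (μ := m) hq
        (aestronglyMeasurable_norm_sub (hv (ns k)) (hv (ns (k + 1))))
      simp only [eLpNorm_one_eq_lintegral_enorm, enorm_norm, one_div] at h1
      refine h1.trans ?_
      gcongr
      exact (hfast k _ (hns.monotone (Nat.le_succ k))).le
    refine ne_top_of_le_ne_top ?_ (ENNReal.tsum_le_tsum hle)
    rw [ENNReal.tsum_mul_right, ENNReal.tsum_geometric]
    refine ENNReal.mul_ne_top ?_ hDfin
    simp
  set s : Set X := {x | G x < ∞} with hs
  have hsm : MeasurableSet s := measurableSet_lt hGm measurable_const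
  have hsae : ∀ᵐ x ∂m, x ∈ s := ae_lt_top hGm hGint
  have hlim : ∀ x, ∃ y : H x,
      Tendsto (fun k => s.indicator (fun _ => (1 : ℝ)) x • v (ns k) x) atTop (𝓝 y) := fun x => by
    by_cases hx : x ∈ s
    · simp only [Set.indicator_of_mem hx, one_smul]
      refine cauchySeq_tendsto_of_complete
        (cauchySeq_of_edist_le_of_tsum_ne_top (fun k => ‖v (ns k) x - v (ns (k + 1)) x‖ₑ)
          (fun k => ?_) (LT.lt.ne hx))
      rw [edist_eq_enorm_sub]
    · exact ⟨0, by simp [Set.indicator_of_notMem hx]⟩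
  choose w hw using hlim
  refine ⟨w, mem_sections_of_tendsto
    (fun k => smul_mem_sections (measurable_const.indicator hsm) (hv (ns k))) hw, ns, hns, ?_⟩
  filter_upwards [hsae] with x hx
  simpa only [Set.indicator_of_mem hx, one_smul] using hw x

/-- Completeness of the space of `L^q` sections. -/
theorem exists_tendsto_secDist [IsFiniteMeasure m] {q : ℝ≥0∞} (hq : 1 ≤ q) {v : ℕ → ∀ x, H x}
    (hv : ∀ n, F.IsLpSection m q (v n))
    (hc : ∀ ε : ℝ≥0∞, 0 < ε → ∃ N, ∀ i ≥ N, ∀ j ≥ N, secDist m q (v i) (v j) < ε) :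
    ∃ w, F.IsLpSection m q w ∧ Tendsto (fun n => secDist m q (v n) w) atTop (𝓝 0) := by
  obtain ⟨w, hw, ns, hns, hae⟩ := exists_subseq_limit hq (fun n => (hv n).1) hc
  have hle : ∀ ε : ℝ≥0∞, 0 < ε → ∃ N, ∀ i ≥ N, secDist m q (v i) w ≤ ε := fun ε hε => by
    obtain ⟨N, hN⟩ := hc ε hε
    refine ⟨N, fun i hi => ?_⟩
    refine (Lp.eLpNorm_lim_le_liminf_eLpNorm (f := fun k x => ‖v i x - v (ns k) x‖)
      (fun k => aestronglyMeasurable_norm_sub (hv i).1 (hv (ns k)).1) _ ?_).trans ?_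
    · filter_upwards [hae] with x hx
      exact (tendsto_const_nhds.sub hx).norm
    · refine liminf_le_of_frequently_le' (Eventually.frequently ?_)
      filter_upwards [eventually_ge_atTop N] with k hk
      exact (hN i hi (ns k) (hk.trans (hns.id_le k))).le
  have ht : Tendsto (fun n => secDist m q (v n) w) atTop (𝓝 0) := by
    rw [ENNReal.tendsto_nhds_zero]
    intro ε hε
    obtain ⟨N, hN⟩ := hle ε hε
    exact eventually_atTop.2 ⟨N, hN⟩
  obtain ⟨N, hN⟩ := hle 1 one_pos
  exact ⟨w, isLpSection_of_secDist_lt_top (hv N) hw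
    ((hN N le_rfl).trans_lt ENNReal.one_lt_top), ht⟩

theorem cauchy_of_tendsto_secDist {q : ℝ≥0∞} (hq : 1 ≤ q) {v : ℕ → ∀ x, H x}
    (hv : ∀ n, v n ∈ F.sections) {w : ∀ x, H x} (hw : w ∈ F.sections)
    (h : Tendsto (fun n => secDist m q (v n) w) atTop (𝓝 0)) :
    ∀ ε : ℝ≥0∞, 0 < ε → ∃ N, ∀ i ≥ N, ∀ j ≥ N, secDist m q (v i) (v j) < ε := by
  intro ε hε
  obtain ⟨N, hN⟩ := eventually_atTop.1 (h.eventually (gt_mem_nhds (ENNReal.half_pos hε.ne')))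
  refine ⟨N, fun i hi j hj => ?_⟩
  calc secDist m q (v i) (v j) ≤ secDist m q (v i) w + secDist m q w (v j) :=
        secDist_triangle hq (hv i) hw (hv j)
    _ < ε / 2 + ε / 2 := by
        rw [secDist_comm q w]
        exact ENNReal.add_lt_add (hN i hi) (hN j hj)
    _ = ε := ENNReal.add_halves ε

/-- Every measurable section is a positive multiple of a bounded one. -/
theorem exists_bounded_rescaling {v : ∀ x, H x} (hv : v ∈ F.sections) :
    ∃ w ∈ F.sections, (∀ x, ‖w x‖ ≤ 1) ∧ ∀ x, ∃ c : ℝ, 0 < c ∧ w x = c • v x := by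
  refine ⟨fun x => (1 + ‖v x‖)⁻¹ • v x,
    smul_mem_sections (measurable_const.add (measurable_norm hv)).inv hv, fun x => ?_,
    fun x => ⟨_, by positivity, rfl⟩⟩
  rw [norm_smul, norm_inv, Real.norm_of_nonneg (by positivity), inv_mul_le_iff₀ (by positivity)]
  linarith

end

end MeasurableHilbertField

/-! ### The carré du champ on the core -/

theorem ccToL2_coeFn {X : Type*} [MetricSpace X] [MeasurableSpace X] [BorelSpace X]
    (m : Measure X) [IsFiniteMeasure m] (f : C_c(X, ℝ)) : ccToL2 m f =ᵐ[m] f :=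
  MemLp.coeFn_toLp _

theorem norm_ccToL2 {X : Type*} [MetricSpace X] [MeasurableSpace X] [BorelSpace X]
    (m : Measure X) [IsFiniteMeasure m] (f : C_c(X, ℝ)) :
    ‖ccToL2 m f‖ = (eLpNorm f 2 m).toReal :=
  Lp.norm_toLp _ _

theorem CompactlySupportedContinuousMap.exists_abs_le {X : Type*} [TopologicalSpace X] (φ : C_c(X, ℝ)) : ∃ C : ℝ, 0 ≤ C ∧ ∀ x, |φ x| ≤ C := by
  obtain ⟨C, hC⟩ := φ.continuous.bounded_above_of_compact_support φ.hasCompactSupport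
  exact ⟨max C 0, le_max_right _ _, fun x => (hC x).trans (le_max_left _ _)⟩

theorem integrable_cc_mul {X : Type*} [MetricSpace X] [MeasurableSpace X] [BorelSpace X]
    {m : Measure X} (φ : C_c(X, ℝ)) {γ : X → ℝ} (hγ : Integrable γ m) :
    Integrable (fun x => φ x * γ x) m := by
  obtain ⟨C, -, hC⟩ := φ.exists_abs_le
  exact hγ.bdd_mul φ.continuous.measurable.aestronglyMeasurable (ae_of_all _ hC)

namespace DirichletForm

theorem form_sq_le {X : Type*} [MeasurableSpace X] {m : Measure X} {E : DirichletForm m}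
    (u v : E.domain) : E.form u v ^ 2 ≤ E.form u u * E.form v v :=
  LinearMap.BilinForm.apply_sq_le_of_symm E.form E.nonneg ⟨E.symm⟩ u v

section

variable {X : Type*} [MetricSpace X] [MeasurableSpace X] [BorelSpace X]
  {m : Measure X} [IsFiniteMeasure m] {E : DirichletForm m}
  {A : NonUnitalSubalgebra ℝ C_c(X, ℝ)}

/-- The algebra `A` as a linear subspace of the domain of the form. -/
def coreMap (hA : E.BasicAssumption A) : A →ₗ[ℝ] E.domain where
  toFun f := ⟨ccToL2 m f, hA.isCore.subset_domain f f.2⟩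
  map_add' f g := Subtype.ext (MemLp.toLp_add
    ((f : C_c(X, ℝ)).continuous.memLp_of_hasCompactSupport (f : C_c(X, ℝ)).hasCompactSupport)
    ((g : C_c(X, ℝ)).continuous.memLp_of_hasCompactSupport (g : C_c(X, ℝ)).hasCompactSupport))
  map_smul' c f := Subtype.ext (MemLp.toLp_const_smul c
    ((f : C_c(X, ℝ)).continuous.memLp_of_hasCompactSupport (f : C_c(X, ℝ)).hasCompactSupport))

theorem coe_coreMap (hA : E.BasicAssumption A) (f : A) :
    (coreMap hA f : Lp ℝ 2 m) = ccToL2 m f := rfl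

theorem coreMap_mem_ccDomain (hA : E.BasicAssumption A) (f : A) :
    (f : C_c(X, ℝ)) ∈ E.ccDomain :=
  hA.isCore.subset_domain f f.2

theorem val_eq_form (hA : E.BasicAssumption A) (f g : A) :
    E.val f g = E.form (coreMap hA f) (coreMap hA g) :=
  dif_pos ⟨coreMap_mem_ccDomain hA f, coreMap_mem_ccDomain hA g⟩

theorem isCarre_gam (hA : E.BasicAssumption A) (f g : A) : E.IsCarre f g (E.Gam f g) := by
  have h := hA.admitsCarre f (coreMap_mem_ccDomain hA f) g (coreMap_mem_ccDomain hA g)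
  rw [Gam, dif_pos h]
  exact h.choose_spec

theorem integrable_gam (hA : E.BasicAssumption A) (f g : A) : Integrable (E.Gam f g) m :=
  (isCarre_gam hA f g).1

theorem integral_mul_gam (hA : E.BasicAssumption A) (f g h : A) :
    ∫ x, (h : C_c(X, ℝ)) x * E.Gam f g x ∂m =
      (1 / 2 : ℝ) * (E.form (coreMap hA (f * h)) (coreMap hA g)
        + E.form (coreMap hA (g * h)) (coreMap hA f)
        - E.form (coreMap hA (f * g)) (coreMap hA h)) := by
  rw [← (isCarre_gam hA f g).2 h (coreMap_mem_ccDomain hA h), ← val_eq_form, ← val_eq_form,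
    ← val_eq_form]
  rfl

/-- Test functions from the core determine integrable functions. -/
theorem ae_eq_zero_of_forall_integral_core [LocallyCompactSpace X]
    [TopologicalSpace.SeparableSpace X] (hA : E.BasicAssumption A) {γ : X → ℝ}
    (hγ : Integrable γ m) (h : ∀ f : A, ∫ x, (f : C_c(X, ℝ)) x * γ x ∂m = 0) :
    ∀ᵐ x ∂m, γ x = 0 := by
  have : SecondCountableTopology X := UniformSpace.secondCountable_of_separable X
  have hcc : ∀ φ : C_c(X, ℝ), ∫ x, φ x * γ x ∂m = 0 := by
    intro φ
    have hle : ∀ ε : ℝ, 0 < ε → |∫ x, φ x * γ x ∂m| ≤ ε * ∫ x, |γ x| ∂m := by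
      intro ε hε
      obtain ⟨f, hf, hfφ⟩ := hA.isCore.uniformly_dense φ ε hε
      have h1 : ∫ x, φ x * γ x ∂m = ∫ x, (φ x - f x) * γ x ∂m := by
        have h2 := h ⟨f, hf⟩
        simp only at h2
        simp only [sub_mul]
        rw [integral_sub (integrable_cc_mul φ hγ) (integrable_cc_mul f hγ), h2, sub_zero]
      rw [h1, ← integral_const_mul]
      refine (abs_integral_le_integral_abs).trans (integral_mono_of_nonneg
        (ae_of_all _ fun _ => abs_nonneg _) (hγ.abs.const_mul ε) (ae_of_all _ fun x => ?_))
      simp only [abs_mul]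
      gcongr
      rw [abs_sub_comm]
      exact (hfφ x).le
    have hlim : Tendsto (fun ε : ℝ => ε * ∫ x, |γ x| ∂m) (𝓝[>] 0) (𝓝 0) := by
      have : Tendsto (fun ε : ℝ => ε * ∫ x, |γ x| ∂m) (𝓝 0) (𝓝 (0 * ∫ x, |γ x| ∂m)) :=
        tendsto_id.mul_const _
      rw [zero_mul] at this
      exact this.mono_left nhdsWithin_le_nhds
    have h0 : |∫ x, φ x * γ x ∂m| ≤ 0 :=
      ge_of_tendsto hlim (by filter_upwards [self_mem_nhdsWithin] with ε hε using hle ε hε)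
    exact abs_nonpos_iff.1 h0
  -- the positive and negative parts of `γ` have the same integrals against test functions
  have := isFiniteMeasure_withDensity_ofReal (μ := m) hγ.2
  have := isFiniteMeasure_withDensity_ofReal (μ := m) hγ.neg.2
  have hm1 : AEMeasurable (fun x => ENNReal.ofReal (γ x)) m := hγ.1.aemeasurable.ennreal_ofReal
  have hm2 : AEMeasurable (fun x => ENNReal.ofReal ((-γ) x)) m :=
    hγ.neg.1.aemeasurable.ennreal_ofReal
  have heq : m.withDensity (fun x => ENNReal.ofReal (γ x))
      = m.withDensity (fun x => ENNReal.ofReal ((-γ) x)) := by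
    refine Measure.ext_of_integral_eq_on_compactlySupported fun φ => ?_
    rw [integral_withDensity_eq_integral_toReal_smul₀ hm1 (ae_of_all _ fun _ => by simp),
      integral_withDensity_eq_integral_toReal_smul₀ hm2 (ae_of_all _ fun _ => by simp),
      ← sub_eq_zero, ← integral_sub, ← hcc φ]
    · refine integral_congr_ae (ae_of_all _ fun x => ?_)
      simp only [smul_eq_mul, Pi.neg_apply, ENNReal.toReal_ofReal', ← sub_mul]
      rw [mul_comm (φ x)]
      congr 1
      rcases le_total 0 (γ x) with h1 | h1
      · rw [max_eq_left h1, max_eq_right (by linarith), sub_zero]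
      · rw [max_eq_right h1, max_eq_left (by linarith)]
        ring
    · refine (integrable_cc_mul φ hγ.pos_part).congr (ae_of_all _ fun x => ?_)
      simp [ENNReal.toReal_ofReal', mul_comm]
    · refine (integrable_cc_mul φ hγ.neg_part).congr (ae_of_all _ fun x => ?_)
      simp [ENNReal.toReal_ofReal', mul_comm]
  have hae := (withDensity_eq_iff hm1 hm2 hγ.lintegral_lt_top.ne).1 heq
  filter_upwards [hae] with x hx
  simp only [Pi.neg_apply] at hx
  rcases le_total 0 (γ x) with h1 | h1
  · rw [ENNReal.ofReal_of_nonpos (show -γ x ≤ 0 by linarith), ENNReal.ofReal_eq_zero] at hx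
    linarith
  · rw [ENNReal.ofReal_of_nonpos h1, eq_comm, ENNReal.ofReal_eq_zero] at hx
    linarith

theorem gam_smul_add [LocallyCompactSpace X] [TopologicalSpace.SeparableSpace X]
    (hA : E.BasicAssumption A) (c : ℝ) (f₁ f₂ g : A) :
    ∀ᵐ x ∂m, E.Gam (c • f₁ + f₂ : A) g x = c * E.Gam f₁ g x + E.Gam f₂ g x := by
  have hi1 := integrable_gam hA f₁ g
  have hi2 := integrable_gam hA f₂ g
  have hi := integrable_gam hA (c • f₁ + f₂) g
  have h := ae_eq_zero_of_forall_integral_core hA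
    (γ := fun x => E.Gam (c • f₁ + f₂ : A) g x - (c * E.Gam f₁ g x + E.Gam f₂ g x))
    (hi.sub ((hi1.const_mul c).add hi2)) (by
      intro h
      have e1 : ∀ x, (h : C_c(X, ℝ)) x *
          (E.Gam (c • f₁ + f₂ : A) g x - (c * E.Gam f₁ g x + E.Gam f₂ g x))
          = (h : C_c(X, ℝ)) x * E.Gam (c • f₁ + f₂ : A) g x
            - (c * ((h : C_c(X, ℝ)) x * E.Gam f₁ g x) + (h : C_c(X, ℝ)) x * E.Gam f₂ g x) :=
        fun x => by ring
      simp only [e1]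
      have j1 := integrable_cc_mul (h : C_c(X, ℝ)) hi1
      have j2 := integrable_cc_mul (h : C_c(X, ℝ)) hi2
      have j := integrable_cc_mul (h : C_c(X, ℝ)) hi
      have e2 := integral_sub j ((j1.const_mul c).add j2)
      simp only [Pi.add_apply] at e2
      rw [e2, integral_add (j1.const_mul c) j2, integral_const_mul, integral_mul_gam hA, integral_mul_gam hA, integral_mul_gam hA]
      simp only [add_mul, smul_mul_assoc, map_add, map_smul,
        LinearMap.add_apply, LinearMap.smul_apply, smul_eq_mul]
      ring)
  filter_upwards [h] with x hx
  linarith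

/-- The Leibniz rule in integrated form; it follows from the polarized defining identity of the
carré du champ alone. -/
theorem form_mul_eq_integral (hA : E.BasicAssumption A) (f g h : A) :
    E.form (coreMap hA (g * h)) (coreMap hA f) =
      ∫ x, ((h : C_c(X, ℝ)) x * E.Gam g f x + (g : C_c(X, ℝ)) x * E.Gam h f x) ∂m := by
  rw [integral_add (integrable_cc_mul _ (integrable_gam hA g f))
    (integrable_cc_mul _ (integrable_gam hA h f)), integral_mul_gam hA, integral_mul_gam hA,
    mul_comm h g, mul_comm g f, mul_comm h f]
  ring

/-- Cutoff functions in the domain of the form: the unit contraction of twice an element of the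
core that is uniformly close to a Urysohn function. -/
theorem exists_cutoff [LocallyCompactSpace X] (hA : E.BasicAssumption A) {K : Set X}
    (hK : IsCompact K) :
    ∃ h ∈ E.ccDomain, (∀ x, 0 ≤ h x ∧ h x ≤ 1) ∧
      ∃ U : Set X, IsOpen U ∧ K ⊆ U ∧ ∀ x ∈ U, h x = 1 := by
  obtain ⟨K', hK', hKK'⟩ := exists_compact_superset hK
  obtain ⟨φ, hφ1, -, hφc, -⟩ := exists_continuous_one_zero_of_isCompact hK' isClosed_empty
    (Set.disjoint_empty K')
  obtain ⟨f, hf, hfφ⟩ := hA.isCore.uniformly_dense ⟨φ, hφc⟩ (1 / 2) (by norm_num)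
  set h : C_c(X, ℝ) := ⟨⟨fun x => min (max 0 (2 * f x)) 1, by fun_prop⟩,
    f.hasCompactSupport.comp_left (g := fun y => min (max 0 (2 * y)) 1) (by simp)⟩ with hh
  have hhx : ∀ x, h x = min (max 0 (2 * f x)) 1 := fun x => rfl
  refine ⟨h, ?_, fun x => ?_, interior K', isOpen_interior, hKK', fun x hx => ?_⟩
  · obtain ⟨u, hu, -⟩ := E.markov (coreMap hA ((2 : ℝ) • ⟨f, hf⟩))
    have : ccToL2 m h = (u : Lp ℝ 2 m) := by
      refine Lp.ext ?_
      filter_upwards [hu, ccToL2_coeFn m h, ccToL2_coeFn m ((2 : ℝ) • f)] with x h1 h2 h3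
      have h3' : ((coreMap hA ((2 : ℝ) • ⟨f, hf⟩) : Lp ℝ 2 m)) x = 2 * f x := h3
      rw [h1, h2, h3', hhx]
    change ccToL2 m h ∈ E.domain
    rw [this]
    exact u.2
  · rw [hhx]
    exact ⟨le_min (le_max_left _ _) zero_le_one, min_le_right _ _⟩
  · have h1 : φ x = 1 := hφ1 (interior_subset hx)
    have h2 : |f x - φ x| < 1 / 2 := hfφ x
    rw [h1] at h2
    have h3 := (abs_lt.1 h2).1
    rw [hhx]
    exact min_eq_right (le_max_of_le_right (by linarith))

/-- By strong locality the form has no killing part: the energy is the integral of the energy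
density. -/
theorem form_eq_integral_gam [LocallyCompactSpace X] [TopologicalSpace.SeparableSpace X]
    (hA : E.BasicAssumption A) (f : A) :
    E.form (coreMap hA f) (coreMap hA f) = ∫ x, E.Gam f f x ∂m := by
  have : SecondCountableTopology X := UniformSpace.secondCountable_of_separable X
  let K := CompactExhaustion.choice X
  choose h hdom h01 U hU hKU hU1 using fun n => exists_cutoff hA (K.isCompact n)
  have hint := integrable_gam hA f f
  have hlim : Tendsto (fun n => ∫ x, h n x * E.Gam f f x ∂m) atTop (𝓝 (∫ x, E.Gam f f x ∂m)) := by
    refine tendsto_integral_of_dominated_convergence (fun x => |E.Gam f f x|)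
      (fun n => (integrable_cc_mul (h n) hint).1) hint.abs (fun n => ae_of_all _ fun x => ?_)
      (ae_of_all _ fun x => ?_)
    · rw [Real.norm_eq_abs, abs_mul, abs_of_nonneg (h01 n x).1]
      exact mul_le_of_le_one_left (abs_nonneg _) (h01 n x).2
    · refine tendsto_const_nhds.congr' ?_
      obtain ⟨n, hn⟩ := K.exists_mem x
      filter_upwards [eventually_ge_atTop n] with k hk
      rw [hU1 k x (hKU k (K.subset hk hn)), one_mul]
  refine tendsto_nhds_unique (tendsto_const_nhds.congr' ?_) hlim
  obtain ⟨N, hN⟩ := K.exists_superset_of_isCompact (f : C_c(X, ℝ)).hasCompactSupport.isCompact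
  filter_upwards [eventually_ge_atTop N] with n hn
  have hsub : tsupport (f : C_c(X, ℝ)) ⊆ U n := hN.trans ((K.subset hn).trans (hKU n))
  have hmul : (f : C_c(X, ℝ)) * h n = f := by
    ext x
    by_cases hx : x ∈ tsupport (f : C_c(X, ℝ))
    · simp [hU1 n x (hsub hx)]
    · simp [image_eq_zero_of_notMem_tsupport hx]
  have hloc : E.val ((f : C_c(X, ℝ)) * f) (h n) = 0 :=
    hA.stronglyLocal _ (coreMap_mem_ccDomain hA (f * f)) _ (hdom n)
      ⟨U n, hU n, (closure_mono (Function.support_mul_subset_left _ _)).trans hsub, 1, hU1 n⟩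
  rw [← (isCarre_gam hA f f).2 (h n) (hdom n), hmul, hloc, val_eq_form hA]
  ring

end

end DirichletForm

namespace VectorFieldBundle

section

variable {X : Type*} [MetricSpace X] [MeasurableSpace X] [BorelSpace X]
  {m : Measure X} [IsFiniteMeasure m] {E : DirichletForm m}
  {A : NonUnitalSubalgebra ℝ C_c(X, ℝ)} {H : X → Type*}
  [∀ x, NormedAddCommGroup (H x)] [∀ x, InnerProductSpace ℝ (H x)]
  [∀ x, CompleteSpace (H x)] (B : VectorFieldBundle E A H)

open DirichletForm MeasurableHilbertField

theorem norm_grad_sq (f : A) : ∀ᵐ x ∂m, ‖B.grad f x‖ ^ 2 = E.Gam f f x := by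
  filter_upwards [B.inner_grad f f] with x hx
  rw [← hx, real_inner_self_eq_norm_sq]

theorem exists_norm_grad_le (hA : E.BasicAssumption A) (f : A) :
    ∃ C : ℝ, 0 ≤ C ∧ ∀ᵐ x ∂m, ‖B.grad f x‖ ≤ C := by
  refine ⟨Real.sqrt (eLpNorm (E.Gam f f) ∞ m).toReal, Real.sqrt_nonneg _, ?_⟩
  filter_upwards [ae_abs_le_toReal_eLpNorm_top (hA.bounded f f.2 f f.2),
    B.norm_grad_sq f] with x hx hx'
  refine Real.le_sqrt_of_sq_le ?_
  rw [hx']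
  exact (le_abs_self _).trans hx

theorem isLpSection_grad (hA : E.BasicAssumption A) (q : ℝ≥0∞) (f : A) :
    B.IsLpSection m q (B.grad f) := by
  obtain ⟨C, -, hC⟩ := B.exists_norm_grad_le hA f
  refine ⟨B.grad_mem f, MemLp.of_bound (aestronglyMeasurable_norm (B.grad_mem f)) C ?_⟩
  simpa only [norm_norm] using hC

/-- The derivation is linear up to null sets, because its inner products are. -/
theorem grad_smul_add [LocallyCompactSpace X] [TopologicalSpace.SeparableSpace X]
    (hA : E.BasicAssumption A) (c : ℝ) (f₁ f₂ : A) :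
    ∀ᵐ x ∂m, B.grad (c • f₁ + f₂) x = c • B.grad f₁ x + B.grad f₂ x := by
  have key : ∀ g : A, ∀ᵐ x ∂m,
      inner ℝ (B.grad (c • f₁ + f₂) x - (c • B.grad f₁ x + B.grad f₂ x)) (B.grad g x) = 0 := by
    intro g
    filter_upwards [gam_smul_add hA c f₁ f₂ g, B.inner_grad (c • f₁ + f₂) g, B.inner_grad f₁ g,
      B.inner_grad f₂ g] with x h h1 h2 h3
    rw [inner_sub_left, inner_add_left, real_inner_smul_left, h1, h2, h3, h]
    ring
  filter_upwards [key (c • f₁ + f₂), key f₁, key f₂] with x h1 h2 h3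
  rw [← sub_eq_zero, ← inner_self_eq_zero (𝕜 := ℝ)]
  conv_lhs => rw [inner_sub_right, inner_add_right, real_inner_smul_right, h1, h2, h3]
  simp

theorem grad_sub [LocallyCompactSpace X] [TopologicalSpace.SeparableSpace X]
    (hA : E.BasicAssumption A) (f₁ f₂ : A) :
    ∀ᵐ x ∂m, B.grad (f₁ - f₂) x = B.grad f₁ x - B.grad f₂ x := by
  have e : f₁ - f₂ = (-1 : ℝ) • f₂ + f₁ := by
    ext x
    simp
    ring
  rw [e]
  filter_upwards [B.grad_smul_add hA (-1) f₂ f₁] with x hx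
  rw [hx, neg_smul, one_smul]
  abel

/-- The `L²` distance of gradients is the energy distance. -/
theorem secDist_grad [LocallyCompactSpace X] [TopologicalSpace.SeparableSpace X]
    (hA : E.BasicAssumption A) (f g : A) :
    secDist m 2 (B.grad f) (B.grad g) = ENNReal.ofReal
      (Real.sqrt (E.form (coreMap hA f - coreMap hA g) (coreMap hA f - coreMap hA g))) := by
  have h1 : secDist m 2 (B.grad f) (B.grad g) = eLpNorm (fun x => ‖B.grad (f - g) x‖) 2 m := by
    refine eLpNorm_congr_ae ?_
    filter_upwards [B.grad_sub hA f g] with x hx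
    rw [hx]
  have h2 := (B.isLpSection_grad hA 2 (f - g)).2
  have h3 : ∫ x, ‖‖B.grad (f - g) x‖‖ ^ (2 : ℝ≥0∞).toReal ∂m
      = ∫ x, E.Gam (f - g : A) (f - g : A) x ∂m := by
    refine integral_congr_ae ?_
    filter_upwards [B.norm_grad_sq (f - g)] with x hx
    rw [norm_norm, ← hx]
    simp
  rw [← map_sub, form_eq_integral_gam hA, h1,
    h2.eLpNorm_eq_integral_rpow_norm (by simp) (by simp), h3, Real.sqrt_eq_rpow]
  simp

end

end VectorFieldBundle

/-! ### Closability of the derivation -/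

namespace MeasurableHilbertField

theorem eLpNorm_inner_sub_le {X : Type*} [MeasurableSpace X] {H : X → Type*}
    [∀ x, NormedAddCommGroup (H x)] [∀ x, InnerProductSpace ℝ (H x)] {m : Measure X} {s v w : ∀ x, H x} {C : ℝ} (hC : ∀ᵐ x ∂m, ‖s x‖ ≤ C)
    (q : ℝ≥0∞) :
    eLpNorm (fun x => (inner ℝ (s x) (v x) : ℝ) - inner ℝ (s x) (w x)) q m
      ≤ ENNReal.ofReal C * secDist m q v w := by
  refine eLpNorm_le_mul_eLpNorm_of_ae_le_mul ?_ q
  filter_upwards [hC] with x hx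
  rw [← inner_sub_right, norm_norm]
  exact (abs_real_inner_le_norm _ _).trans (by gcongr)

section

variable {X : Type*} [MeasurableSpace X] {H : X → Type*}
  [∀ x, NormedAddCommGroup (H x)] [∀ x, InnerProductSpace ℝ (H x)]
  [∀ x, CompleteSpace (H x)] {F : MeasurableHilbertField X H} {m : Measure X}

theorem integrable_inner_of_bounded {s v : ∀ x, H x} (hs : s ∈ F.sections) {C : ℝ}
    (hC : ∀ᵐ x ∂m, ‖s x‖ ≤ C) (hv : F.IsLpSection m 1 v) :
    Integrable (fun x => (inner ℝ (s x) (v x) : ℝ)) m := by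
  refine ((memLp_one_iff_integrable.1 hv.2).const_mul C).mono'
    (measurable_inner hs hv.1).aestronglyMeasurable ?_
  filter_upwards [hC] with x hx
  exact (abs_real_inner_le_norm _ _).trans (by gcongr)

theorem tendsto_integral_inner {s : ∀ x, H x} (hs : s ∈ F.sections) {C : ℝ}
    (hC : ∀ᵐ x ∂m, ‖s x‖ ≤ C) {v : ℕ → ∀ x, H x} (hv : ∀ n, F.IsLpSection m 1 (v n))
    {w : ∀ x, H x} (hw : F.IsLpSection m 1 w)
    (h : Tendsto (fun n => secDist m 1 (v n) w) atTop (𝓝 0)) :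
    Tendsto (fun n => ∫ x, (inner ℝ (s x) (v n x) : ℝ) ∂m) atTop
      (𝓝 (∫ x, (inner ℝ (s x) (w x) : ℝ) ∂m)) := by
  refine tendsto_integral_of_L1' _ (integrable_inner_of_bounded hs hC hw).1
    (Eventually.of_forall fun n => integrable_inner_of_bounded hs hC (hv n)) ?_
  have h1 := ENNReal.Tendsto.const_mul (a := ENNReal.ofReal C) h (Or.inr ENNReal.ofReal_ne_top)
  rw [mul_zero] at h1
  exact tendsto_of_tendsto_of_tendsto_of_le_of_le tendsto_const_nhds h1 (fun _ => bot_le)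
    (fun n => eLpNorm_inner_sub_le hC 1)

end

end MeasurableHilbertField

theorem tendsto_integral_mul_of_bounded {X : Type*} [MeasurableSpace X] {m : Measure X}
    {κ : X → ℝ} (hκ : AEStronglyMeasurable κ m) {C : ℝ} (hC : ∀ᵐ x ∂m, |κ x| ≤ C)
    {φ : ℕ → X → ℝ} (hφ : ∀ n, Integrable (φ n) m)
    (h : Tendsto (fun n => eLpNorm (φ n) 1 m) atTop (𝓝 0)) :
    Tendsto (fun n => ∫ x, κ x * φ n x ∂m) atTop (𝓝 0) := by
  have h0 : Tendsto (fun n => ∫ x, κ x * φ n x ∂m) atTop (𝓝 (∫ _, (0 : ℝ) ∂m)) := by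
    refine tendsto_integral_of_L1' _ aestronglyMeasurable_const
      (Eventually.of_forall fun n => (hφ n).bdd_mul hκ hC) ?_
    have h1 := ENNReal.Tendsto.const_mul (a := ENNReal.ofReal C) h (Or.inr ENNReal.ofReal_ne_top)
    rw [mul_zero] at h1
    refine tendsto_of_tendsto_of_tendsto_of_le_of_le tendsto_const_nhds h1 (fun _ => bot_le)
      (fun n => eLpNorm_le_mul_eLpNorm_of_ae_le_mul ?_ 1)
    filter_upwards [hC] with x hx
    rw [Pi.sub_apply, sub_zero, norm_mul]
    gcongr
    exact hx
  simpa using h0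

namespace DirichletForm

theorem form_add_le {X : Type*} [MeasurableSpace X] {m : Measure X} (E : DirichletForm m)
    (u v : E.domain) : E.form (u + v) (u + v) ≤ 2 * E.form u u + 2 * E.form v v := by
  have h := E.nonneg (u - v)
  simp only [map_add, map_sub, LinearMap.add_apply, LinearMap.sub_apply] at h ⊢
  linarith

theorem form_neg {X : Type*} [MeasurableSpace X] {m : Measure X} (E : DirichletForm m)
    (u : E.domain) : E.form (-u) (-u) = E.form u u := by
  simp

theorem tendsto_form {X : Type*} [MeasurableSpace X] {m : Measure X} {E : DirichletForm m}
    (v : E.domain) {u : ℕ → E.domain} {f : E.domain}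
    (h : Tendsto (fun n => E.form (u n - f) (u n - f)) atTop (𝓝 0)) :
    Tendsto (fun n => E.form v (u n)) atTop (𝓝 (E.form v f)) := by
  rw [tendsto_iff_norm_sub_tendsto_zero]
  have h1 : Tendsto (fun n => Real.sqrt (E.form v v * E.form (u n - f) (u n - f))) atTop (𝓝 0) := by
    have := (h.const_mul (E.form v v)).sqrt
    rwa [mul_zero, Real.sqrt_zero] at this
  refine squeeze_zero (fun _ => norm_nonneg _) (fun n => ?_) h1
  rw [← map_sub, Real.norm_eq_abs]
  exact Real.abs_le_sqrt (form_sq_le v (u n - f))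

end DirichletForm

namespace VectorFieldBundle

section

variable {X : Type*} [MetricSpace X] [MeasurableSpace X] [BorelSpace X]
  {m : Measure X} [IsFiniteMeasure m] {E : DirichletForm m}
  {A : NonUnitalSubalgebra ℝ C_c(X, ℝ)} {H : X → Type*}
  [∀ x, NormedAddCommGroup (H x)] [∀ x, InnerProductSpace ℝ (H x)]
  [∀ x, CompleteSpace (H x)] (B : VectorFieldBundle E A H)

open DirichletForm MeasurableHilbertField

theorem secDist_grad_le [LocallyCompactSpace X]
    [TopologicalSpace.SeparableSpace X] (hA : E.BasicAssumption A) (u : E.domain) {ε : ℝ} {f g : A}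
    (hf : E.form (coreMap hA f - u) (coreMap hA f - u) < ε)
    (hg : E.form (coreMap hA g - u) (coreMap hA g - u) < ε) :
    secDist m 2 (B.grad f) (B.grad g) ≤ ENNReal.ofReal (Real.sqrt (4 * ε)) := by
  rw [B.secDist_grad hA]
  refine ENNReal.ofReal_le_ofReal (Real.sqrt_le_sqrt ?_)
  have h := E.form_add_le (coreMap hA f - u) (-(coreMap hA g - u))
  have e : coreMap hA f - u + -(coreMap hA g - u) = coreMap hA f - coreMap hA g := by abel
  rw [e, form_neg] at h
  linarith

/-- The gradient of an element of the domain of the form, as a limit of gradients of elements of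
the core. -/
theorem exists_limit_grad [LocallyCompactSpace X]
    [TopologicalSpace.SeparableSpace X] (hA : E.BasicAssumption A) {u : E.domain} {φ : ℕ → A}
    (h : Tendsto (fun n => E.form (coreMap hA (φ n) - u) (coreMap hA (φ n) - u)) atTop (𝓝 0)) :
    ∃ d : ∀ x, H x, B.IsLpSection m 2 d ∧
      Tendsto (fun n => secDist m 2 (B.grad (φ n)) d) atTop (𝓝 0) ∧
      ∀ (ε : ℝ) (f : A), E.form (coreMap hA f - u) (coreMap hA f - u) < ε →
        secDist m 2 (B.grad f) d ≤ ENNReal.ofReal (Real.sqrt (4 * ε)) := by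
  have hsmall : ∀ ε : ℝ, 0 < ε →
      ∀ᶠ n in atTop, E.form (coreMap hA (φ n) - u) (coreMap hA (φ n) - u) < ε :=
    fun ε hε => h.eventually (gt_mem_nhds hε)
  obtain ⟨d, hd, hlim⟩ := exists_tendsto_secDist (F := B.toMeasurableHilbertField) (m := m)
    one_le_two (fun n => B.isLpSection_grad hA 2 (φ n)) (by
      intro ε hε
      obtain ⟨r, hr0, hr⟩ := ENNReal.lt_iff_exists_real_btwn.1 hε
      have hr' : 0 < r := by simpa using hr.1
      obtain ⟨N, hN⟩ := eventually_atTop.1 (hsmall (r ^ 2 / 4) (by positivity))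
      refine ⟨N, fun i hi j hj =>
        (B.secDist_grad_le hA u (hN i hi) (hN j hj)).trans_lt ?_⟩
      have e : 4 * (r ^ 2 / 4) = r ^ 2 := by ring
      rw [e, Real.sqrt_sq hr0]
      exact hr.2)
  refine ⟨d, hd, hlim, fun ε f hf => ?_⟩
  have h1 : Tendsto (fun n => ENNReal.ofReal (Real.sqrt (4 * ε)) + secDist m 2 (B.grad (φ n)) d)
      atTop (𝓝 (ENNReal.ofReal (Real.sqrt (4 * ε)) + 0)) := tendsto_const_nhds.add hlim
  rw [add_zero] at h1
  refine ge_of_tendsto h1 ?_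
  filter_upwards [hsmall ε ((E.nonneg _).trans_lt hf)] with n hn
  exact (secDist_triangle one_le_two (B.grad_mem f) (B.grad_mem (φ n)) hd.1).trans
    (by gcongr; exact B.secDist_grad_le hA u hf hn)

/-- Integration by parts against an element of the domain of the generator, with gradient `d`. -/
theorem integral_by_parts (hA : E.BasicAssumption A) {u : E.domain} {w : Lp ℝ 2 m}
    (hw : E.IsGenerator u w) {φ : ℕ → A}
    (h : Tendsto (fun n => E.form (coreMap hA (φ n) - u) (coreMap hA (φ n) - u)) atTop (𝓝 0))
    {d : ∀ x, H x} (hd : B.IsLpSection m 2 d)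
    (hlim : Tendsto (fun n => secDist m 2 (B.grad (φ n)) d) atTop (𝓝 0)) (g k : A) :
    ∫ x, inner ℝ ((k : C_c(X, ℝ)) x • B.grad g x + (g : C_c(X, ℝ)) x • B.grad k x) (d x) ∂m =
      - ∫ x, w x * ((g : C_c(X, ℝ)) x * (k : C_c(X, ℝ)) x) ∂m := by
  obtain ⟨Cg, hCg0, hCg⟩ := (g : C_c(X, ℝ)).exists_abs_le
  obtain ⟨Ck, hCk0, hCk⟩ := (k : C_c(X, ℝ)).exists_abs_le
  obtain ⟨Dg, hDg0, hDg⟩ := B.exists_norm_grad_le hA g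
  obtain ⟨Dk, hDk0, hDk⟩ := B.exists_norm_grad_le hA k
  have hs : (fun x => (k : C_c(X, ℝ)) x • B.grad g x + (g : C_c(X, ℝ)) x • B.grad k x)
      ∈ B.sections := B.sections.add_mem
    (smul_mem_sections (k : C_c(X, ℝ)).continuous.measurable (B.grad_mem g))
    (smul_mem_sections (g : C_c(X, ℝ)).continuous.measurable (B.grad_mem k))
  have hbound : ∀ᵐ x ∂m, ‖(k : C_c(X, ℝ)) x • B.grad g x + (g : C_c(X, ℝ)) x • B.grad k x‖
      ≤ Ck * Dg + Cg * Dk := by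
    filter_upwards [hDg, hDk] with x h1 h2
    refine (norm_add_le _ _).trans ?_
    rw [norm_smul, norm_smul]
    exact add_le_add (mul_le_mul (hCk x) h1 (norm_nonneg _) hCk0)
      (mul_le_mul (hCg x) h2 (norm_nonneg _) hCg0)
  have hlim1 := tendsto_secDist_mono one_ne_zero one_le_two (fun n => B.grad_mem (φ n)) hd.1 hlim
  have hL := tendsto_integral_inner hs hbound (fun n => B.isLpSection_grad hA 1 (φ n))
    (hd.mono one_le_two) hlim1
  have hR := tendsto_form (coreMap hA (g * k)) h
  have e : ∀ n, E.form (coreMap hA (g * k)) (coreMap hA (φ n)) = ∫ x, inner ℝ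
      ((k : C_c(X, ℝ)) x • B.grad g x + (g : C_c(X, ℝ)) x • B.grad k x) (B.grad (φ n) x) ∂m := by
    intro n
    rw [form_mul_eq_integral hA]
    refine integral_congr_ae ?_
    filter_upwards [B.inner_grad g (φ n), B.inner_grad k (φ n)] with x h1 h2
    rw [inner_add_left, real_inner_smul_left, real_inner_smul_left, h1, h2]
  simp only [e] at hR
  rw [tendsto_nhds_unique hL hR, E.symm, hw, L2.inner_def]
  congr 1
  refine integral_congr_ae ?_
  filter_upwards [ccToL2_coeFn m ((g * k : A) : C_c(X, ℝ))] with x hx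
  rw [coe_coreMap, hx]
  simp [mul_comm]

/-- The energy density obtained by `L¹` approximation is the squared norm of the limit gradient;
this is what makes the gradients of the elements in the generator assumption bounded. -/
theorem norm_sq_eq_of_tendsto {φ : ℕ → A} {d : ∀ x, H x} (hd : d ∈ B.sections)
    (hA : E.BasicAssumption A)
    (hlim : Tendsto (fun n => secDist m 2 (B.grad (φ n)) d) atTop (𝓝 0)) {γ : X → ℝ}
    (hγ : Integrable γ m)
    (h : Tendsto (fun n => ∫ x, |E.Gam (φ n) (φ n) x - γ x| ∂m) atTop (𝓝 0)) :
    ∀ᵐ x ∂m, ‖d x‖ ^ 2 = γ x := by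
  have h1 : TendstoInMeasure m (fun n => E.Gam (φ n) (φ n)) atTop γ := by
    refine tendstoInMeasure_of_tendsto_eLpNorm one_ne_zero
      (fun n => (integrable_gam hA (φ n) (φ n)).1) hγ.1 ?_
    have h2 : ∀ n, eLpNorm (E.Gam (φ n) (φ n) - γ) 1 m
        = ENNReal.ofReal (∫ x, |E.Gam (φ n) (φ n) x - γ x| ∂m) := fun n => by
      rw [eLpNorm_one_eq_lintegral_enorm,
        ← ofReal_integral_norm_eq_lintegral_enorm ((integrable_gam hA (φ n) (φ n)).sub hγ)]
      rfl
    simp only [h2]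
    simpa using ENNReal.tendsto_ofReal h
  obtain ⟨ns, hns, hae⟩ := h1.exists_seq_tendsto_ae
  obtain ⟨ks, hks, hae'⟩ := exists_subseq_tendsto_ae (two_ne_zero)
    (fun n => B.grad_mem (φ (ns n))) hd (hlim.comp hns.tendsto_atTop)
  have hsq : ∀ᵐ x ∂m, ∀ n, ‖B.grad (φ n) x‖ ^ 2 = E.Gam (φ n) (φ n) x :=
    ae_all_iff.2 fun n => B.norm_grad_sq (φ n)
  filter_upwards [hae, hae', hsq] with x h1 h2 h3
  have h4 := (h2.norm).pow 2
  simp only [h3] at h4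
  exact tendsto_nhds_unique h4 (h1.comp hks.tendsto_atTop)

/-- Elements of the generator domain with bounded data annihilate the defect of closability: if
`gₙ → 0` and `∂gₙ → v`, then `v` is orthogonal to their gradients. -/
theorem inner_eq_zero_of_generator [LocallyCompactSpace X]
    [TopologicalSpace.SeparableSpace X] (hA : E.BasicAssumption A) {u : E.domain} {w : Lp ℝ 2 m}
    (hw : E.IsGenerator u w) (hwb : MemLp w ∞ m) {φ : ℕ → A}
    (h : Tendsto (fun n => E.form (coreMap hA (φ n) - u) (coreMap hA (φ n) - u)) atTop (𝓝 0))
    {d : ∀ x, H x} (hd : B.IsLpSection m 2 d)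
    (hlim : Tendsto (fun n => secDist m 2 (B.grad (φ n)) d) atTop (𝓝 0))
    {D : ℝ} (hD : ∀ᵐ x ∂m, ‖d x‖ ≤ D) {g : ℕ → A} {v : ∀ x, H x} (hv : B.IsLpSection m 1 v)
    (hg : Tendsto (fun n => eLpNorm (g n : C_c(X, ℝ)) 1 m) atTop (𝓝 0))
    (hgv : Tendsto (fun n => secDist m 1 (B.grad (g n)) v) atTop (𝓝 0)) :
    ∀ᵐ x ∂m, inner ℝ (d x) (v x) = 0 := by
  refine ae_eq_zero_of_forall_integral_core hA (integrable_inner_of_bounded hd.1 hD hv)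
    fun k => ?_
  obtain ⟨Ck, hCk0, hCk⟩ := (k : C_c(X, ℝ)).exists_abs_le
  obtain ⟨Dk, hDk0, hDk⟩ := B.exists_norm_grad_le hA k
  set W := (eLpNorm w ∞ m).toReal
  have hW : ∀ᵐ x ∂m, |w x| ≤ W := ae_abs_le_toReal_eLpNorm_top hwb
  have hkm : Measurable (k : C_c(X, ℝ)) := (k : C_c(X, ℝ)).continuous.measurable
  have hs : (fun x => (k : C_c(X, ℝ)) x • d x) ∈ B.sections := smul_mem_sections hkm hd.1
  have hsb : ∀ᵐ x ∂m, ‖(k : C_c(X, ℝ)) x • d x‖ ≤ Ck * D := by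
    filter_upwards [hD] with x hx
    rw [norm_smul]
    exact mul_le_mul (hCk x) hx (norm_nonneg _) hCk0
  have hL := tendsto_integral_inner hs hsb (fun n => B.isLpSection_grad hA 1 (g n)) hv hgv
  set κ : X → ℝ := fun x => -(w x * (k : C_c(X, ℝ)) x + inner ℝ (B.grad k x) (d x)) with hκ
  have hκm : AEStronglyMeasurable κ m :=
    ((hwb.1.mul hkm.aestronglyMeasurable).add
      (measurable_inner (B.grad_mem k) hd.1).aestronglyMeasurable).neg
  have hκb : ∀ᵐ x ∂m, |κ x| ≤ W * Ck + Dk * D := by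
    filter_upwards [hW, hDk, hD] with x h1 h2 h3
    rw [hκ, abs_neg]
    refine (abs_add_le _ _).trans (add_le_add ?_ ?_)
    · rw [abs_mul]
      exact mul_le_mul h1 (hCk x) (abs_nonneg _) ((abs_nonneg _).trans h1)
    · exact (abs_real_inner_le_norm _ _).trans (mul_le_mul h2 h3 (norm_nonneg _) hDk0)
  have hgi : ∀ n, Integrable (g n : C_c(X, ℝ)) m := fun n =>
    (g n : C_c(X, ℝ)).continuous.integrable_of_hasCompactSupport (g n : C_c(X, ℝ)).hasCompactSupport
  have hR := tendsto_integral_mul_of_bounded hκm hκb hgi hg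
  -- integration by parts moves the derivative off `gₙ`
  have e : ∀ n, ∫ x, κ x * (g n : C_c(X, ℝ)) x ∂m
      = ∫ x, inner ℝ ((k : C_c(X, ℝ)) x • d x) (B.grad (g n) x) ∂m := by
    intro n
    have hd1 : B.IsLpSection m 1 d := hd.mono one_le_two
    have i1 : Integrable (fun x => inner ℝ ((k : C_c(X, ℝ)) x • d x) (B.grad (g n) x)) m :=
      integrable_inner_of_bounded hs hsb (B.isLpSection_grad hA 1 (g n))
    have i2 : Integrable (fun x => (g n : C_c(X, ℝ)) x * inner ℝ (B.grad k x) (d x)) m :=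
      integrable_cc_mul _ (integrable_inner_of_bounded (B.grad_mem k) hDk hd1)
    have i3 : Integrable (fun x => w x * ((g n : C_c(X, ℝ)) x * (k : C_c(X, ℝ)) x)) m :=
      (((g n * k : A) : C_c(X, ℝ)).continuous.integrable_of_hasCompactSupport
        ((g n * k : A) : C_c(X, ℝ)).hasCompactSupport).bdd_mul hwb.1 hW
    have h0 := B.integral_by_parts hA hw h hd hlim (g n) k
    have e1 : ∀ x, inner ℝ ((k : C_c(X, ℝ)) x • B.grad (g n) x
        + (g n : C_c(X, ℝ)) x • B.grad k x) (d x)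
        = inner ℝ ((k : C_c(X, ℝ)) x • d x) (B.grad (g n) x)
          + (g n : C_c(X, ℝ)) x * inner ℝ (B.grad k x) (d x) := fun x => by
      rw [inner_add_left, real_inner_smul_left, real_inner_smul_left, real_inner_smul_left,
        real_inner_comm (B.grad (g n) x)]
    simp only [e1] at h0
    rw [integral_add i1 i2] at h0
    have e2 : ∀ x, κ x * (g n : C_c(X, ℝ)) x = -(w x * ((g n : C_c(X, ℝ)) x * (k : C_c(X, ℝ)) x))
        - (g n : C_c(X, ℝ)) x * inner ℝ (B.grad k x) (d x) := fun x => by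
      simp only [hκ]
      ring
    simp only [e2]
    have e3 := integral_sub i3.neg i2
    simp only [Pi.neg_apply] at e3
    rw [e3, integral_neg]
    linarith
  simp only [e] at hR
  rw [← tendsto_nhds_unique hL hR]
  simp only [real_inner_smul_left]

/-- A section orthogonal to all gradients of core elements vanishes. -/
theorem ae_eq_zero_of_inner_grad {v : ∀ x, H x} (hv : v ∈ B.sections)
    (h : ∀ a : A, ∀ᵐ x ∂m, inner ℝ (v x) (B.grad a x) = 0) : ∀ᵐ x ∂m, v x = 0 := by
  obtain ⟨w, hw, hw1, hwv⟩ := exists_bounded_rescaling hv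
  have hwL : B.IsLpSection m 2 w := ⟨hw, MemLp.of_bound (aestronglyMeasurable_norm hw) 1
    (ae_of_all _ fun x => by simpa only [norm_norm] using hw1 x)⟩
  -- `w` is orthogonal to the sums `S` that approximate it, so pointwise `‖w‖ ≤ ‖S - w‖`
  have hle : ∀ ε : ℝ, 0 < ε → eLpNorm (fun x => ‖w x‖) 2 m ≤ ENNReal.ofReal ε := by
    intro ε hε
    obtain ⟨n, a, b, hab⟩ := B.dense_span w hwL ε hε
    refine le_trans (eLpNorm_mono_ae ?_) hab.le
    filter_upwards [ae_all_iff.2 fun i => h (a i)] with x hx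
    rw [norm_norm, norm_norm]
    obtain ⟨c, hc, hcw⟩ := hwv x
    set S := ∑ i, (b i : C_c(X, ℝ)) x • B.grad (a i) x with hS
    have h0 : inner ℝ (w x) S = 0 := by
      rw [hS, inner_sum]
      refine Finset.sum_eq_zero fun i _ => ?_
      rw [real_inner_smul_right, hcw, real_inner_smul_left, hx i]
      simp
    have h1 : ‖w x‖ * ‖w x‖ ≤ ‖w x‖ * ‖S - w x‖ := by
      have h2 : ‖w x‖ * ‖w x‖ = -inner ℝ (w x) (S - w x) := by
        rw [inner_sub_right, h0, real_inner_self_eq_norm_mul_norm]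
        ring
      rw [h2]
      exact (neg_le_abs _).trans (abs_real_inner_le_norm _ _)
    rcases (norm_nonneg (w x)).eq_or_lt with h3 | h3
    · rw [← h3]
      exact norm_nonneg _
    · exact le_of_mul_le_mul_left h1 h3
  have h0 : eLpNorm (fun x => ‖w x‖) 2 m = 0 := by
    refine le_antisymm (ENNReal.le_of_forall_pos_le_add fun ε hε _ => ?_) bot_le
    simpa using hle ε hε
  rw [eLpNorm_eq_zero_iff (aestronglyMeasurable_norm hw) two_ne_zero] at h0
  filter_upwards [h0] with x hx
  obtain ⟨c, hc, hcw⟩ := hwv x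
  have h1 : w x = 0 := norm_eq_zero.1 hx
  rw [hcw] at h1
  exact (smul_eq_zero.1 h1).resolve_left hc.ne'

/-- Closability in `L¹` under the generator assumption: the gradients of the bounded elements of
the generator domain are orthogonal to the limit and approximate the gradients of the core. -/
theorem ae_eq_zero_of_generatorAssumption [LocallyCompactSpace X]
    [TopologicalSpace.SeparableSpace X] (hA : E.BasicAssumption A)
    (hAL : E.GeneratorAssumption A) {g : ℕ → A} {v : ∀ x, H x} (hv : B.IsLpSection m 1 v)
    (hg : Tendsto (fun n => eLpNorm (g n : C_c(X, ℝ)) 1 m) atTop (𝓝 0))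
    (hgv : Tendsto (fun n => secDist m 1 (B.grad (g n)) v) atTop (𝓝 0)) :
    ∀ᵐ x ∂m, v x = 0 := by
  obtain ⟨AL, hAL1, hAL2⟩ := hAL
  have key : ∀ (a : A) (ε : ℝ), 0 < ε → ∃ d ∈ B.sections,
      (∀ᵐ x ∂m, inner ℝ (d x) (v x) = 0) ∧
      secDist m 2 d (B.grad a) ≤ ENNReal.ofReal (Real.sqrt (4 * ε)) := by
    intro a ε hε
    obtain ⟨u, hu, huε⟩ := hAL2 (coreMap hA a) ε hε
    obtain ⟨⟨w, hw, hwb⟩, γ, ⟨hγi, φ, us, hus, hlim, hlimγ⟩, hγb⟩ := hAL1 u hu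
    have hus' : ∀ n, us n = coreMap hA (φ n) := fun n => Subtype.ext (hus n).symm
    simp only [hus'] at hlim
    have h : Tendsto (fun n => E.form (coreMap hA (φ n) - u) (coreMap hA (φ n) - u))
        atTop (𝓝 0) := squeeze_zero (fun n => E.nonneg _)
      (fun n => le_add_of_nonneg_right (sq_nonneg _)) hlim
    obtain ⟨d, hd, hdlim, hdist⟩ := B.exists_limit_grad hA h
    have hdγ := B.norm_sq_eq_of_tendsto hd.1 hA hdlim hγi hlimγ
    have hD : ∀ᵐ x ∂m, ‖d x‖ ≤ Real.sqrt (eLpNorm γ ∞ m).toReal := by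
      filter_upwards [ae_abs_le_toReal_eLpNorm_top hγb, hdγ] with x hx hx'
      refine Real.le_sqrt_of_sq_le ?_
      rw [hx']
      exact (le_abs_self _).trans hx
    refine ⟨d, hd.1, B.inner_eq_zero_of_generator hA hw hwb h hd hdlim hD hv hg hgv, ?_⟩
    rw [secDist_comm]
    refine hdist ε a ?_
    have e : coreMap hA a - u = -(u - coreMap hA a) := by abel
    rw [e, form_neg]
    exact (le_add_of_nonneg_right (sq_nonneg _)).trans_lt huε
  refine B.ae_eq_zero_of_inner_grad hv.1 fun a => ?_
  obtain ⟨w, hw, hw1, hwv⟩ := exists_bounded_rescaling hv.1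
  choose d hd hdv hda using fun n : ℕ => key a (1 / ((n : ℝ) + 1)) (by positivity)
  have h2 : Tendsto (fun n => secDist m 2 (d n) (B.grad a)) atTop (𝓝 0) := by
    have h3 := (tendsto_one_div_add_atTop_nhds_zero_nat (𝕜 := ℝ)).const_mul 4 |>.sqrt
    have h4 := ENNReal.tendsto_ofReal h3
    simp only [mul_zero, Real.sqrt_zero, ENNReal.ofReal_zero] at h4
    exact tendsto_of_tendsto_of_tendsto_of_le_of_le tendsto_const_nhds h4 (fun _ => bot_le) hda
  have h1 := tendsto_secDist_mono one_ne_zero one_le_two hd (B.grad_mem a) h2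
  have hle : ∀ n, eLpNorm (fun x => (inner ℝ (w x) (B.grad a x) : ℝ)) 1 m
      ≤ secDist m 1 (d n) (B.grad a) := by
    intro n
    refine eLpNorm_mono_ae ?_
    filter_upwards [hdv n] with x hx
    obtain ⟨c, -, hcw⟩ := hwv x
    have h0 : inner ℝ (w x) (d n x) = 0 := by
      rw [hcw, real_inner_smul_left, real_inner_comm, hx, mul_zero]
    rw [norm_norm, ← sub_zero (inner ℝ (w x) (B.grad a x)), ← h0, ← inner_sub_right,
      norm_sub_rev (d n x)]
    exact (abs_real_inner_le_norm _ _).trans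
      (mul_le_of_le_one_left (norm_nonneg _) (hw1 x))
  have h0 := le_antisymm (ge_of_tendsto' h1 hle) bot_le
  rw [eLpNorm_eq_zero_iff (measurable_inner hw (B.grad_mem a)).aestronglyMeasurable
    one_ne_zero] at h0
  filter_upwards [h0] with x hx
  obtain ⟨c, hc, hcw⟩ := hwv x
  have h3 : inner ℝ (w x) (B.grad a x) = 0 := hx
  rw [hcw, real_inner_smul_left] at h3
  exact (mul_eq_zero.1 h3).resolve_left hc.ne'

/-- Closability in `L²`, from the closedness of the form. -/
theorem ae_eq_zero_of_tendsto_two [LocallyCompactSpace X]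
    [TopologicalSpace.SeparableSpace X] (hA : E.BasicAssumption A) {g : ℕ → A} {v : ∀ x, H x}
    (hv : v ∈ B.sections)
    (hg : Tendsto (fun n => eLpNorm (g n : C_c(X, ℝ)) 2 m) atTop (𝓝 0))
    (hgv : Tendsto (fun n => secDist m 2 (B.grad (g n)) v) atTop (𝓝 0)) :
    ∀ᵐ x ∂m, v x = 0 := by
  have hnorm : Tendsto (fun n => ‖coreMap hA (g n)‖) atTop (𝓝 0) := by
    have h1 := (ENNReal.tendsto_toReal ENNReal.zero_ne_top).comp hg
    refine h1.congr fun n => ?_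
    rw [Function.comp_apply, ← norm_ccToL2]
    rfl
  have hform : ∀ i j, E.form (coreMap hA (g i) - coreMap hA (g j))
      (coreMap hA (g i) - coreMap hA (g j))
      = (secDist m 2 (B.grad (g i)) (B.grad (g j))).toReal ^ 2 := fun i j => by
    rw [B.secDist_grad hA, ENNReal.toReal_ofReal (Real.sqrt_nonneg _), Real.sq_sqrt (E.nonneg _)]
  obtain ⟨u, hu⟩ := E.closed (fun n => coreMap hA (g n)) (by
    intro ε hε
    set δ := Real.sqrt (ε / 8) with hδ
    have hδ0 : 0 < δ := Real.sqrt_pos.2 (by positivity)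
    have hδ2 : δ ^ 2 = ε / 8 := Real.sq_sqrt (by positivity)
    obtain ⟨N₁, hN₁⟩ := cauchy_of_tendsto_secDist one_le_two (fun n => B.grad_mem (g n)) hv hgv
      (ENNReal.ofReal δ) (by simpa using hδ0)
    obtain ⟨N₂, hN₂⟩ := eventually_atTop.1 (hnorm.eventually (gt_mem_nhds hδ0))
    refine ⟨max N₁ N₂, fun i hi j hj => ?_⟩
    have h1 := hN₁ i ((le_max_left _ _).trans hi) j ((le_max_left _ _).trans hj)
    have h2 : (secDist m 2 (B.grad (g i)) (B.grad (g j))).toReal ≤ δ :=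
      ENNReal.toReal_le_of_le_ofReal hδ0.le h1.le
    have h3 : ‖coreMap hA (g i) - coreMap hA (g j)‖ ≤ 2 * δ := by
      have := norm_sub_le (coreMap hA (g i)) (coreMap hA (g j))
      have := hN₂ i ((le_max_right _ _).trans hi)
      have := hN₂ j ((le_max_right _ _).trans hj)
      linarith
    rw [hform]
    have h4 := pow_le_pow_left₀ ENNReal.toReal_nonneg h2 2
    have h5 := pow_le_pow_left₀ (norm_nonneg _) h3 2
    nlinarith)
  -- the limit in the form domain is `0`, since `gₙ → 0` in `L²`
  have hu0 : u = 0 := by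
    have h1 : Tendsto (fun n => ‖coreMap hA (g n) - u‖ ^ 2) atTop (𝓝 0) :=
      squeeze_zero (fun _ => sq_nonneg _) (fun n => le_add_of_nonneg_left (E.nonneg _)) hu
    have h2 : Tendsto (fun n => ‖coreMap hA (g n) - u‖) atTop (𝓝 0) := by
      have := h1.sqrt
      simpa only [Real.sqrt_sq (norm_nonneg _), Real.sqrt_zero] using this
    exact tendsto_nhds_unique (tendsto_iff_norm_sub_tendsto_zero.2 h2)
      (tendsto_zero_iff_norm_tendsto_zero.2 hnorm)
  have hE : Tendsto (fun n => E.form (coreMap hA (g n)) (coreMap hA (g n))) atTop (𝓝 0) := by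
    simp only [hu0, sub_zero] at hu
    exact squeeze_zero (fun _ => E.nonneg _) (fun n => le_add_of_nonneg_right (sq_nonneg _)) hu
  have hgrad0 : ∀ᵐ x ∂m, B.grad 0 x = 0 := by
    filter_upwards [B.grad_sub hA 0 0] with x hx
    have e : (0 : A) - 0 = 0 := Subtype.ext (sub_self _)
    rwa [e, sub_self] at hx
  have hlim0 : Tendsto (fun n => secDist m 2 (B.grad (g n)) (B.grad 0)) atTop (𝓝 0) := by
    have h1 := ENNReal.tendsto_ofReal hE.sqrt
    simp only [B.secDist_grad hA, map_zero, sub_zero]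
    simpa using h1
  have h0 : secDist m 2 v (B.grad 0) = 0 := by
    have h1 := hgv.add hlim0
    rw [add_zero] at h1
    refine le_antisymm (ge_of_tendsto' h1 fun n => ?_) bot_le
    rw [secDist_comm 2 (B.grad (g n)) v]
    exact secDist_triangle one_le_two hv (B.grad_mem _) (B.grad_mem _)
  filter_upwards [ae_eq_of_secDist_eq_zero two_ne_zero hv (B.grad_mem 0) h0, hgrad0] with x h1 h2
  rw [h1, h2]

/-- The derivation is closable from `L^p` to the `L^p` sections. -/
theorem grad_closable [LocallyCompactSpace X]
    [TopologicalSpace.SeparableSpace X] (hA : E.BasicAssumption A) {p : ℝ} (hp : 1 < p)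
    (hAL : p < 2 → E.GeneratorAssumption A) {g : ℕ → A} {v : ∀ x, H x}
    (hv : B.IsLpSection m (ENNReal.ofReal p) v)
    (hg : Tendsto (fun n => eLpNorm (g n : C_c(X, ℝ)) (ENNReal.ofReal p) m) atTop (𝓝 0))
    (hgv : Tendsto (fun n => secDist m (ENNReal.ofReal p) (B.grad (g n)) v) atTop (𝓝 0)) :
    ∀ᵐ x ∂m, v x = 0 := by
  have hmeas : ∀ n, AEStronglyMeasurable (g n : C_c(X, ℝ)) m := fun n =>
    (g n : C_c(X, ℝ)).continuous.measurable.aestronglyMeasurable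
  rcases lt_or_ge p 2 with h | h
  · have hp1 : 1 ≤ ENNReal.ofReal p := by simpa using hp.le
    exact B.ae_eq_zero_of_generatorAssumption hA (hAL h) (hv.mono hp1)
      (tendsto_eLpNorm_mono_exponent one_ne_zero hp1 hmeas hg)
      (tendsto_secDist_mono one_ne_zero hp1 (fun n => B.grad_mem (g n)) hv.1 hgv)
  · have hp2 : 2 ≤ ENNReal.ofReal p := by
      rw [← ENNReal.ofReal_ofNat 2]
      exact ENNReal.ofReal_le_ofReal h
    exact B.ae_eq_zero_of_tendsto_two hA hv.1
      (tendsto_eLpNorm_mono_exponent two_ne_zero hp2 hmeas hg)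
      (tendsto_secDist_mono two_ne_zero hp2 (fun n => B.grad_mem (g n)) hv.1 hgv)

end

end VectorFieldBundle

namespace MeasurableHilbertField

theorem secDist_smul_add_le {X : Type*} [MeasurableSpace X] {H : X → Type*}
    [∀ x, NormedAddCommGroup (H x)] [∀ x, InnerProductSpace ℝ (H x)]
    [∀ x, CompleteSpace (H x)] {F : MeasurableHilbertField X H} {m : Measure X} {q : ℝ≥0∞}
    (hq : 1 ≤ q) (c : ℝ) {v v' w w' : ∀ x, H x} (hv : v ∈ F.sections) (hv' : v' ∈ F.sections)
    (hw : w ∈ F.sections) (hw' : w' ∈ F.sections) :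
    secDist m q (c • v + v') (c • w + w') ≤ ‖c‖ₑ * secDist m q v w + secDist m q v' w' := by
  rw [secDist, secDist, ← eLpNorm_const_smul]
  refine le_trans (eLpNorm_mono_real (g := (‖c‖ • fun x => ‖v x - w x‖)
    + fun x => ‖v' x - w' x‖) fun x => ?_) ((eLpNorm_add_le
      ((aestronglyMeasurable_norm_sub hv hw).const_smul _)
      (aestronglyMeasurable_norm_sub hv' hw') hq).trans (le_of_eq ?_))
  · simp only [Pi.add_apply, Pi.smul_apply, smul_eq_mul, norm_norm]
    have e : c • v x + v' x - (c • w x + w' x) = c • (v x - w x) + (v' x - w' x) := by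
      rw [smul_sub]
      abel
    rw [e, ← norm_smul]
    exact norm_add_le _ _
  · rw [eLpNorm_const_smul, eLpNorm_const_smul, enorm_norm]

end MeasurableHilbertField

/-! ### Sobolev functions and their gradients -/

theorem aestronglyMeasurable_cc_sub_Lp {X : Type*} [MetricSpace X] [MeasurableSpace X]
    [BorelSpace X] {m : Measure X} {p : ℝ} (f : C_c(X, ℝ)) (u : Lp ℝ (ENNReal.ofReal p) m) :
    AEStronglyMeasurable (fun x => f x - u x) m :=
  f.continuous.measurable.aestronglyMeasurable.sub (Lp.aestronglyMeasurable u)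

namespace VectorFieldBundle

section

variable {X : Type*} [MetricSpace X] [MeasurableSpace X] [BorelSpace X]
  {m : Measure X} [IsFiniteMeasure m] {E : DirichletForm m}
  {A : NonUnitalSubalgebra ℝ C_c(X, ℝ)} {H : X → Type*}
  [∀ x, NormedAddCommGroup (H x)] [∀ x, InnerProductSpace ℝ (H x)]
  [∀ x, CompleteSpace (H x)] (B : VectorFieldBundle E A H)

open DirichletForm MeasurableHilbertField

/-- The section `v` is a gradient of `u`, and `u` and `v` are simultaneously approximated by
elements of the core supported in `Ω`. -/
def HasGradientOn (p : ℝ) (Ω : Set X) (u : Lp ℝ (ENNReal.ofReal p) m) (v : ∀ x, H x) : Prop :=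
  B.IsLpSection m (ENNReal.ofReal p) v ∧ ∃ φ : ℕ → A,
    (∀ n, tsupport (φ n : C_c(X, ℝ)) ⊆ Ω) ∧
    Tendsto (fun n => eLpNorm (fun x => (φ n : C_c(X, ℝ)) x - u x) (ENNReal.ofReal p) m)
      atTop (𝓝 0) ∧
    Tendsto (fun n => secDist m (ENNReal.ofReal p) (B.grad (φ n)) v) atTop (𝓝 0)

variable {B} {p : ℝ} {Ω : Set X}

theorem HasGradientOn.isGradient {u : Lp ℝ (ENNReal.ofReal p) m} {v : ∀ x, H x}
    (h : B.HasGradientOn p Ω u v) : B.IsGradient p u v := by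
  obtain ⟨hv, φ, -, h1, h2⟩ := h
  exact ⟨hv, φ, h1, h2⟩

theorem hasGradientOn_univ_iff {u : Lp ℝ (ENNReal.ofReal p) m} {v : ∀ x, H x} :
    B.HasGradientOn p Set.univ u v ↔ B.IsGradient p u v :=
  ⟨HasGradientOn.isGradient, fun ⟨hv, φ, h1, h2⟩ => ⟨hv, φ, fun _ => Set.subset_univ _, h1, h2⟩⟩

theorem HasGradientOn.mono {Ω' : Set X} (hΩ : Ω ⊆ Ω') {u : Lp ℝ (ENNReal.ofReal p) m}
    {v : ∀ x, H x} (h : B.HasGradientOn p Ω u v) : B.HasGradientOn p Ω' u v := by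
  obtain ⟨hv, φ, h0, h1, h2⟩ := h
  exact ⟨hv, φ, fun n => (h0 n).trans hΩ, h1, h2⟩

theorem HasGradientOn.congr {u : Lp ℝ (ENNReal.ofReal p) m} {v w : ∀ x, H x}
    (h : B.HasGradientOn p Ω u v) (hw : w ∈ B.sections) (hvw : ∀ᵐ x ∂m, v x = w x) :
    B.HasGradientOn p Ω u w := by
  obtain ⟨hv, φ, h0, h1, h2⟩ := h
  refine ⟨⟨hw, hv.2.ae_eq ?_⟩, φ, h0, h1, h2.congr fun n =>
    secDist_congr (ae_of_all _ fun _ => rfl) hvw⟩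
  filter_upwards [hvw] with x hx
  rw [hx]

theorem HasGradientOn.smul_add [LocallyCompactSpace X] [TopologicalSpace.SeparableSpace X]
    (hA : E.BasicAssumption A) (hp : 1 < p) (c : ℝ) {u u' : Lp ℝ (ENNReal.ofReal p) m}
    {v v' : ∀ x, H x} (h : B.HasGradientOn p Ω u v) (h' : B.HasGradientOn p Ω u' v') :
    B.HasGradientOn p Ω (c • u + u') (c • v + v') := by
  have hq : 1 ≤ ENNReal.ofReal p := by simpa using hp.le
  obtain ⟨hv, φ, h0, h1, h2⟩ := h
  obtain ⟨hv', φ', h0', h1', h2'⟩ := h'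
  refine ⟨(hv.smul c).add hv', fun n => c • φ n + φ' n, fun n => ?_, ?_, ?_⟩
  · refine (tsupport_add _ _).trans (Set.union_subset ?_ (h0' n))
    exact (closure_mono (Function.support_const_smul_subset c _)).trans (h0 n)
  · have h3 := (ENNReal.Tendsto.const_mul (a := ‖c‖ₑ) h1 (Or.inr enorm_ne_top)).add h1'
    rw [mul_zero, add_zero] at h3
    refine tendsto_of_tendsto_of_tendsto_of_le_of_le tendsto_const_nhds h3 (fun _ => bot_le)
      fun n => ?_
    have e : (fun x => ((c • φ n + φ' n : A) : C_c(X, ℝ)) x - (c • u + u' : Lp ℝ _ m) x) =ᵐ[m]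
        (c • fun x => (φ n : C_c(X, ℝ)) x - u x) + fun x => (φ' n : C_c(X, ℝ)) x - u' x := by
      filter_upwards [Lp.coeFn_add (c • u) u', Lp.coeFn_smul c u] with x e1 e2
      rw [e1]
      simp only [Pi.add_apply, Pi.smul_apply, e2]
      simp
      ring
    rw [eLpNorm_congr_ae e]
    refine (eLpNorm_add_le ((aestronglyMeasurable_cc_sub_Lp _ u).const_smul c)
      (aestronglyMeasurable_cc_sub_Lp _ u') hq).trans ?_
    rw [eLpNorm_const_smul]
  · have h3 := (ENNReal.Tendsto.const_mul (a := ‖c‖ₑ) h2 (Or.inr enorm_ne_top)).add h2'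
    rw [mul_zero, add_zero] at h3
    refine tendsto_of_tendsto_of_tendsto_of_le_of_le tendsto_const_nhds h3 (fun _ => bot_le)
      fun n => ?_
    rw [secDist_congr (B.grad_smul_add hA c (φ n) (φ' n)) (ae_of_all _ fun _ => rfl)]
    exact secDist_smul_add_le hq c (B.grad_mem _) (B.grad_mem _) hv.1 hv'.1

theorem HasGradientOn.sub [LocallyCompactSpace X] [TopologicalSpace.SeparableSpace X]
    (hA : E.BasicAssumption A) (hp : 1 < p) {u u' : Lp ℝ (ENNReal.ofReal p) m}
    {v v' : ∀ x, H x} (h : B.HasGradientOn p Ω u v) (h' : B.HasGradientOn p Ω u' v') :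
    B.HasGradientOn p Ω (u - u') (v - v') := by
  have e : u - u' = (-1 : ℝ) • u' + u := by
    rw [neg_one_smul]
    abel
  have e' : v - v' = (-1 : ℝ) • v' + v := by
    rw [neg_one_smul]
    abel
  rw [e, e']
  exact h'.smul_add hA hp (-1) h

theorem HasGradientOn.add [LocallyCompactSpace X] [TopologicalSpace.SeparableSpace X]
    (hA : E.BasicAssumption A) (hp : 1 < p) {u u' : Lp ℝ (ENNReal.ofReal p) m}
    {v v' : ∀ x, H x} (h : B.HasGradientOn p Ω u v) (h' : B.HasGradientOn p Ω u' v') :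
    B.HasGradientOn p Ω (u + u') (v + v') := by
  simpa only [one_smul] using h.smul_add hA hp 1 h'

theorem hasGradientOn_zero [LocallyCompactSpace X] [TopologicalSpace.SeparableSpace X]
    (hA : E.BasicAssumption A) (p : ℝ) (Ω : Set X) :
    B.HasGradientOn p Ω (0 : Lp ℝ (ENNReal.ofReal p) m) 0 := by
  have h0 : ∀ᵐ x ∂m, B.grad 0 x = (0 : ∀ x, H x) x := by
    have e : (0 : A) - 0 = 0 := Subtype.ext (sub_self _)
    filter_upwards [B.grad_sub hA 0 0] with x hx
    rwa [e, sub_self] at hx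
  refine ⟨⟨B.sections.zero_mem, by simp⟩, fun _ => 0, fun _ => ?_, ?_, ?_⟩
  · have : tsupport ((0 : A) : C_c(X, ℝ)) = ∅ := by simp
    rw [this]
    exact Set.empty_subset _
  · refine tendsto_const_nhds.congr fun n => ?_
    rw [eq_comm, eLpNorm_congr_ae (g := fun _ => (0 : ℝ)), eLpNorm_zero']
    filter_upwards [Lp.coeFn_zero ℝ (ENNReal.ofReal p) m] with x hx
    rw [hx]
    simp
  · refine tendsto_const_nhds.congr fun n => ?_
    rw [secDist_congr h0 (ae_of_all _ fun _ => rfl)]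
    simp [secDist]

/-- Gradients are unique up to null sets. -/
theorem HasGradientOn.ae_eq [LocallyCompactSpace X] [TopologicalSpace.SeparableSpace X]
    (hA : E.BasicAssumption A) (hp : 1 < p) (hAL : p < 2 → E.GeneratorAssumption A)
    {u : Lp ℝ (ENNReal.ofReal p) m} {v v' : ∀ x, H x} {Ω' : Set X}
    (h : B.HasGradientOn p Ω u v) (h' : B.HasGradientOn p Ω' u v') : ∀ᵐ x ∂m, v x = v' x := by
  obtain ⟨hv, φ, -, h1, h2⟩ :=
    (h.mono (Set.subset_univ _)).sub hA hp (h'.mono (Set.subset_univ _))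
  rw [sub_self] at h1
  have h3 : ∀ n, eLpNorm (fun x => (φ n : C_c(X, ℝ)) x - (0 : Lp ℝ (ENNReal.ofReal p) m) x)
      (ENNReal.ofReal p) m = eLpNorm (φ n : C_c(X, ℝ)) (ENNReal.ofReal p) m := fun n => by
    refine eLpNorm_congr_ae ?_
    filter_upwards [Lp.coeFn_zero ℝ (ENNReal.ofReal p) m] with x hx
    rw [hx]
    simp
  simp only [h3] at h1
  filter_upwards [B.grad_closable hA hp hAL hv h1 h2] with x hx
  exact sub_eq_zero.1 hx

/-- The graph of the gradient on `Ω` is closed. -/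
theorem HasGradientOn.of_tendsto (hp : 1 < p) {u : ℕ → Lp ℝ (ENNReal.ofReal p) m}
    {v : ℕ → ∀ x, H x} (h : ∀ n, B.HasGradientOn p Ω (u n) (v n))
    {u₀ : Lp ℝ (ENNReal.ofReal p) m} {v₀ : ∀ x, H x} (hv₀ : B.IsLpSection m (ENNReal.ofReal p) v₀)
    (hu : Tendsto (fun n => eLpNorm (⇑(u n) - ⇑u₀) (ENNReal.ofReal p) m) atTop (𝓝 0))
    (hv : Tendsto (fun n => secDist m (ENNReal.ofReal p) (v n) v₀) atTop (𝓝 0)) :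
    B.HasGradientOn p Ω u₀ v₀ := by
  have hq : 1 ≤ ENNReal.ofReal p := by simpa using hp.le
  have hpos : ∀ n : ℕ, (0 : ℝ≥0∞) < ((n : ℝ≥0∞))⁻¹ := fun n => by simp
  have hch : ∀ n, ∃ φ : A, tsupport (φ : C_c(X, ℝ)) ⊆ Ω ∧
      eLpNorm (fun x => (φ : C_c(X, ℝ)) x - u n x) (ENNReal.ofReal p) m < (n : ℝ≥0∞)⁻¹ ∧
      secDist m (ENNReal.ofReal p) (B.grad φ) (v n) < (n : ℝ≥0∞)⁻¹ := fun n => by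
    obtain ⟨-, φ, h0, h1, h2⟩ := h n
    obtain ⟨k, hk1, hk2⟩ := ((h1.eventually (gt_mem_nhds (hpos n))).and
      (h2.eventually (gt_mem_nhds (hpos n)))).exists
    exact ⟨φ k, h0 k, hk1, hk2⟩
  -- a diagonal sequence
  choose φ hφ0 hφ1 hφ2 using hch
  refine ⟨hv₀, φ, hφ0, ?_, ?_⟩
  · have h3 := ENNReal.tendsto_inv_nat_nhds_zero.add hu
    rw [add_zero] at h3
    refine tendsto_of_tendsto_of_tendsto_of_le_of_le tendsto_const_nhds h3 (fun _ => bot_le)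
      fun n => ?_
    have e : (fun x => (φ n : C_c(X, ℝ)) x - u₀ x)
        = (fun x => (φ n : C_c(X, ℝ)) x - u n x) + (⇑(u n) - ⇑u₀) := by
      funext x
      simp
    rw [e]
    exact (eLpNorm_add_le (aestronglyMeasurable_cc_sub_Lp _ _)
      ((Lp.aestronglyMeasurable _).sub (Lp.aestronglyMeasurable _)) hq).trans
      (add_le_add (hφ1 n).le le_rfl)
  · have h3 := ENNReal.tendsto_inv_nat_nhds_zero.add hv
    rw [add_zero] at h3
    refine tendsto_of_tendsto_of_tendsto_of_le_of_le tendsto_const_nhds h3 (fun _ => bot_le)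
      fun n => ?_
    exact (secDist_triangle hq (B.grad_mem _) (h n).1.1 hv₀.1).trans
      (add_le_add (hφ2 n).le le_rfl)

/-- Functions approximated by core elements supported in `Ω` vanish outside `Ω`, so that the
Poincaré inequality on `Ω` controls the norm on the whole space. -/
theorem HasGradientOn.ae_eq_zero (hp : 1 < p) (hΩ : IsOpen Ω) {u : Lp ℝ (ENNReal.ofReal p) m}
    {v : ∀ x, H x} (h : B.HasGradientOn p Ω u v) : ∀ᵐ x ∂m, x ∉ Ω → u x = 0 := by
  obtain ⟨-, φ, h0, h1, -⟩ := h
  have hle : ∀ n, eLpNorm (Ωᶜ.indicator u) (ENNReal.ofReal p) m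
      ≤ eLpNorm (fun x => (φ n : C_c(X, ℝ)) x - u x) (ENNReal.ofReal p) m := fun n => by
    refine eLpNorm_mono fun x => ?_
    by_cases hx : x ∈ Ω
    · simp [hx]
    · have h2 : (φ n : C_c(X, ℝ)) x = 0 :=
        image_eq_zero_of_notMem_tsupport fun h3 => hx (h0 n h3)
      simp [hx, h2]
  have h2 := le_antisymm (ge_of_tendsto' h1 hle) bot_le
  rw [eLpNorm_eq_zero_iff ((Lp.aestronglyMeasurable u).indicator hΩ.measurableSet.compl)
    (by simp; linarith)] at h2
  filter_upwards [h2] with x hx hxΩ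
  simpa [hxΩ] using hx

theorem pEnergy_eq (B : VectorFieldBundle E A H) (f : A) (p : ℝ) :
    E.pEnergy p f = ∫ x, ‖B.grad f x‖ ^ p ∂m := by
  refine integral_congr_ae ?_
  filter_upwards [B.norm_grad_sq f] with x hx
  rw [← hx, ← Real.rpow_natCast, ← Real.rpow_mul (norm_nonneg _)]
  congr 1
  push_cast
  ring

theorem secDist_grad_eq_pEnergy [LocallyCompactSpace X] [TopologicalSpace.SeparableSpace X]
    (hA : E.BasicAssumption A) (hp : 1 < p) (f g : A) :
    secDist m (ENNReal.ofReal p) (B.grad f) (B.grad g)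
      = ENNReal.ofReal (E.pEnergy p ((f : C_c(X, ℝ)) - g) ^ (1 / p)) := by
  have h1 : secDist m (ENNReal.ofReal p) (B.grad f) (B.grad g)
      = eLpNorm (fun x => ‖B.grad (f - g) x‖) (ENNReal.ofReal p) m := by
    refine eLpNorm_congr_ae ?_
    filter_upwards [B.grad_sub hA f g] with x hx
    rw [hx]
  have e : ((f : C_c(X, ℝ)) - g) = ((f - g : A) : C_c(X, ℝ)) := rfl
  rw [h1, e, B.pEnergy_eq, eLpNorm_ofReal_eq (by linarith) (B.isLpSection_grad hA _ _).2]
  simp only [abs_norm]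

theorem tendsto_pEnergy (hA : E.BasicAssumption A) (hp : 1 < p) {φ : ℕ → A} {v : ∀ x, H x}
    (hv : B.IsLpSection m (ENNReal.ofReal p) v)
    (h : Tendsto (fun n => secDist m (ENNReal.ofReal p) (B.grad (φ n)) v) atTop (𝓝 0)) :
    Tendsto (fun n => E.pEnergy p (φ n)) atTop (𝓝 (∫ x, ‖v x‖ ^ p ∂m)) := by
  have hq : 1 ≤ ENNReal.ofReal p := by simpa using hp.le
  have hp0 : 0 < p := by linarith
  have hpow : ∀ {w : ∀ x, H x}, B.IsLpSection m (ENNReal.ofReal p) w →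
      ∫ x, ‖w x‖ ^ p ∂m = (secDist m (ENNReal.ofReal p) w 0).toReal ^ p := fun {w} hw => by
    have h0 : 0 ≤ ∫ x, ‖w x‖ ^ p ∂m := integral_nonneg fun x => by positivity
    simp only [secDist, Pi.zero_apply, sub_zero]
    rw [eLpNorm_ofReal_eq hp0 hw.2]
    simp only [abs_norm]
    rw [ENNReal.toReal_ofReal (by positivity), ← Real.rpow_mul h0, one_div_mul_cancel hp0.ne',
      Real.rpow_one]
  have hz : (0 : ∀ x, H x) ∈ B.sections := B.sections.zero_mem
  have hfin : secDist m (ENNReal.ofReal p) v 0 ≠ ∞ := by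
    simpa only [secDist, Pi.zero_apply, sub_zero] using hv.2.2.ne
  have hlim : Tendsto (fun n => secDist m (ENNReal.ofReal p) (B.grad (φ n)) 0) atTop
      (𝓝 (secDist m (ENNReal.ofReal p) v 0)) := by
    have h1 := h.add_const (secDist m (ENNReal.ofReal p) v 0)
    rw [zero_add] at h1
    have h2 := ENNReal.Tendsto.sub (tendsto_const_nhds (x := secDist m (ENNReal.ofReal p) v 0)) h
      (Or.inl hfin)
    rw [tsub_zero] at h2
    refine tendsto_of_tendsto_of_tendsto_of_le_of_le h2 h1 (fun n => ?_)
      fun n => secDist_triangle hq (B.grad_mem _) hv.1 hz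
    simp only
    rw [tsub_le_iff_left, secDist_comm _ (B.grad (φ n)) v]
    exact secDist_triangle hq hv.1 (B.grad_mem _) hz
  rw [hpow hv]
  simp only [B.pEnergy_eq, hpow (B.isLpSection_grad hA _ _)]
  exact ((ENNReal.tendsto_toReal hfin).comp hlim).rpow_const (Or.inr hp0.le)

/-- Approximating sequences in the sense of the energy seminorm have converging gradients. -/
theorem exists_gradient_of_approximates [LocallyCompactSpace X]
    [TopologicalSpace.SeparableSpace X] (hA : E.BasicAssumption A) (hp : 1 < p) {φ : ℕ → A}
    {u : Lp ℝ (ENNReal.ofReal p) m}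
    (h : E.Approximates p (fun n => (φ n : C_c(X, ℝ))) u) :
    ∃ v, B.IsLpSection m (ENNReal.ofReal p) v ∧
      Tendsto (fun n => secDist m (ENNReal.ofReal p) (B.grad (φ n)) v) atTop (𝓝 0) := by
  refine exists_tendsto_secDist (F := B.toMeasurableHilbertField) (by simpa using hp.le)
    (fun n => B.isLpSection_grad hA _ (φ n)) fun ε hε => ?_
  obtain ⟨r, hr0, hr⟩ := ENNReal.lt_iff_exists_real_btwn.1 hε
  have hr' : 0 < r := by simpa using hr.1
  obtain ⟨N, hN⟩ := h.1 r hr'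
  refine ⟨N, fun i hi j hj => ?_⟩
  rw [secDist_grad_eq_pEnergy hA hp]
  exact ((ENNReal.ofReal_lt_ofReal_iff hr').2 (hN i hi j hj)).trans hr.2

theorem approximates_of_tendsto [LocallyCompactSpace X]
    [TopologicalSpace.SeparableSpace X] (hA : E.BasicAssumption A) (hp : 1 < p) {φ : ℕ → A}
    {u : Lp ℝ (ENNReal.ofReal p) m} {v : ∀ x, H x}
    (hv : v ∈ B.sections)
    (h1 : Tendsto (fun n => eLpNorm (fun x => (φ n : C_c(X, ℝ)) x - u x) (ENNReal.ofReal p) m)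
      atTop (𝓝 0))
    (h2 : Tendsto (fun n => secDist m (ENNReal.ofReal p) (B.grad (φ n)) v) atTop (𝓝 0)) :
    E.Approximates p (fun n => (φ n : C_c(X, ℝ))) u := by
  refine ⟨fun ε hε => ?_, h1⟩
  obtain ⟨N, hN⟩ := cauchy_of_tendsto_secDist (by simpa using hp.le) (fun n => B.grad_mem (φ n))
    hv h2 (ENNReal.ofReal ε) (by simpa using hε)
  refine ⟨N, fun i hi j hj => ?_⟩
  have h3 := hN i hi j hj
  rw [secDist_grad_eq_pEnergy hA hp] at h3
  exact (ENNReal.ofReal_lt_ofReal_iff hε).1 h3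

theorem mem_sobolev_iff [LocallyCompactSpace X] [TopologicalSpace.SeparableSpace X]
    (B : VectorFieldBundle E A H) (hA : E.BasicAssumption A) (hp : 1 < p)
    {u : Lp ℝ (ENNReal.ofReal p) m} : u ∈ E.sobolev A p Ω ↔ ∃ v, B.HasGradientOn p Ω u v := by
  constructor
  · rintro ⟨φ, hφ, happ⟩
    obtain ⟨v, hv, hlim⟩ := exists_gradient_of_approximates (B := B) hA hp
      (φ := fun n => ⟨φ n, (hφ n).1⟩) happ
    exact ⟨v, hv, fun n => ⟨φ n, (hφ n).1⟩, fun n => (hφ n).2, happ.2, hlim⟩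
  · rintro ⟨v, hv, φ, h0, h1, h2⟩
    exact ⟨fun n => φ n, fun n => ⟨(φ n).2, h0 n⟩, approximates_of_tendsto hA hp hv.1 h1 h2⟩

theorem HasGradientOn.sobolevEnergy_eq [LocallyCompactSpace X]
    [TopologicalSpace.SeparableSpace X] (hA : E.BasicAssumption A) (hp : 1 < p)
    (hAL : p < 2 → E.GeneratorAssumption A) {u : Lp ℝ (ENNReal.ofReal p) m} {v : ∀ x, H x}
    (h : B.HasGradientOn p Ω u v) : E.sobolevEnergy A p u = ∫ x, ‖v x‖ ^ p ∂m := by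
  have hex : ∃ e : ℝ, ∃ φ : ℕ → C_c(X, ℝ), (∀ n, φ n ∈ A) ∧ E.Approximates p φ u ∧
      Tendsto (fun n => E.pEnergy p (φ n)) atTop (𝓝 e) := by
    obtain ⟨hv, φ, -, h1, h2⟩ := h
    exact ⟨_, fun n => φ n, fun n => (φ n).2, approximates_of_tendsto hA hp hv.1 h1 h2,
      tendsto_pEnergy hA hp hv h2⟩
  -- the chosen limit may come from any approximating sequence; uniqueness of the gradient
  -- makes the value independent of it
  have key : ∀ e : ℝ, (∃ φ : ℕ → C_c(X, ℝ), (∀ n, φ n ∈ A) ∧ E.Approximates p φ u ∧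
      Tendsto (fun n => E.pEnergy p (φ n)) atTop (𝓝 e)) → e = ∫ x, ‖v x‖ ^ p ∂m := by
    rintro e ⟨φ, hφ, happ, hlim⟩
    obtain ⟨w, hw, hwlim⟩ := exists_gradient_of_approximates (B := B) hA hp
      (φ := fun n => ⟨φ n, hφ n⟩) happ
    have hwg : B.HasGradientOn p Set.univ u w :=
      ⟨hw, fun n => ⟨φ n, hφ n⟩, fun _ => Set.subset_univ _, happ.2, hwlim⟩
    have hen := tendsto_pEnergy (B := B) hA hp (φ := fun n => ⟨φ n, hφ n⟩) hw hwlim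
    rw [tendsto_nhds_unique hlim hen]
    refine integral_congr_ae ?_
    filter_upwards [h.ae_eq hA hp hAL hwg] with x hx
    rw [hx]
  rw [sobolevEnergy, dif_pos hex]
  exact key _ hex.choose_spec

theorem hasGradientOn_gradient [LocallyCompactSpace X] [TopologicalSpace.SeparableSpace X]
    (hA : E.BasicAssumption A) (hp : 1 < p) (hAL : p < 2 → E.GeneratorAssumption A)
    {u : Lp ℝ (ENNReal.ofReal p) m} {v : ∀ x, H x} (h : B.HasGradientOn p Ω u v) :
    B.HasGradientOn p Ω u (B.gradient p u) ∧ ∀ᵐ x ∂m, v x = B.gradient p u x := by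
  have hex : ∃ v, B.IsGradient p u v := ⟨v, h.isGradient⟩
  have hg : B.IsGradient p u (B.gradient p u) := by
    rw [gradient, dif_pos hex]
    exact hex.choose_spec
  have hae := h.ae_eq hA hp hAL (hasGradientOn_univ_iff.2 hg)
  exact ⟨h.congr hg.1.1 hae, hae⟩

/-- The Poincaré inequality in terms of norms on the whole space. -/
theorem exists_eLpNorm_le_of_poincare [LocallyCompactSpace X]
    [TopologicalSpace.SeparableSpace X] (B : VectorFieldBundle E A H)
    (hA : E.BasicAssumption A) (hp : 1 < p)
    (hAL : p < 2 → E.GeneratorAssumption A) (hΩ : IsOpen Ω) (hP : E.Poincare A p Ω) :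
    ∃ C : ℝ≥0∞, C ≠ ∞ ∧ ∀ (u : Lp ℝ (ENNReal.ofReal p) m) (v : ∀ x, H x),
      B.HasGradientOn p Ω u v →
      eLpNorm u (ENNReal.ofReal p) m ≤ C * eLpNorm (fun x => ‖v x‖) (ENNReal.ofReal p) m := by
  obtain ⟨c, hc, hPc⟩ := hP
  have hp0 : 0 < p := by linarith
  refine ⟨ENNReal.ofReal (c ^ (1 / p)), ENNReal.ofReal_ne_top, fun u v h => ?_⟩
  have h1 := hPc u ((B.mem_sobolev_iff hA hp).2 ⟨v, h⟩)
  rw [h.sobolevEnergy_eq hA hp hAL, setIntegral_eq_integral_of_ae_compl_eq_zero (by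
    filter_upwards [h.ae_eq_zero hp hΩ] with x hx hxΩ
    rw [hx hxΩ, abs_zero, Real.zero_rpow hp0.ne'])] at h1
  rw [eLpNorm_ofReal_eq hp0 (Lp.memLp u), eLpNorm_ofReal_eq hp0 h.1.2,
    ← ENNReal.ofReal_mul (by positivity), ← Real.mul_rpow hc.le
      (integral_nonneg fun x => by positivity)]
  simp only [abs_norm]
  refine ENNReal.ofReal_le_ofReal (Real.rpow_le_rpow (integral_nonneg fun x => by positivity) h1
    (by positivity))

end

end VectorFieldBundle

/-! ### The direct method -/

namespace MeasurableHilbertField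

section

variable {X : Type*} [MeasurableSpace X] {H : X → Type*}
  [∀ x, NormedAddCommGroup (H x)] [∀ x, InnerProductSpace ℝ (H x)]
  [∀ x, CompleteSpace (H x)] {F : MeasurableHilbertField X H} {m : Measure X}

theorem IsLpSection.integrable_norm_rpow {p : ℝ} (hp : 0 < p) {v : ∀ x, H x}
    (hv : F.IsLpSection m (ENNReal.ofReal p) v) : Integrable (fun x => ‖v x‖ ^ p) m := by
  have h := hv.2.integrable_norm_rpow (by simpa using hp) (by simp)
  simpa only [norm_norm, ENNReal.toReal_ofReal hp.le] using h

/-- Uniform convexity of the space of `L^p` sections: a sequence bounded in norm whose midpoint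
defects vanish is Cauchy. -/
theorem cauchy_of_midpoint_defect {p : ℝ} (hp : 1 < p) {v : ℕ → ∀ x, H x}
    (hv : ∀ n, F.IsLpSection m (ENNReal.ofReal p) (v n)) {M : ℝ}
    (hM : ∀ n, ∫ x, ‖v n x‖ ^ p ∂m ≤ M)
    (hmid : ∀ ε : ℝ, 0 < ε → ∃ K : ℕ, ∀ i ≥ K, ∀ j ≥ K,
      (∫ x, ‖v i x‖ ^ p ∂m + ∫ x, ‖v j x‖ ^ p ∂m) / 2
        - ∫ x, ‖(1 / 2 : ℝ) • (v i x + v j x)‖ ^ p ∂m < ε) :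
    ∀ ε : ℝ≥0∞, 0 < ε → ∃ N, ∀ i ≥ N, ∀ j ≥ N,
      secDist m (ENNReal.ofReal p) (v i) (v j) < ε := by
  intro ε hε
  have hp0 : 0 < p := by linarith
  obtain ⟨r, hr0, hr⟩ := ENNReal.lt_iff_exists_real_btwn.1 hε
  have hr' : 0 < r := by simpa using hr.1
  have hM0 : 0 ≤ M := (integral_nonneg fun x => by positivity).trans (hM 0)
  set η : ℝ := r ^ p / 2 / (2 * M + 1) with hη
  have hη0 : 0 < η := by positivity
  obtain ⟨C, hC, hconv⟩ := exists_norm_sub_rpow_le hp hη0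
  obtain ⟨K, hK⟩ := hmid (r ^ p / 2 / C) (by positivity)
  refine ⟨K, fun i hi j hj => ?_⟩
  have hi1 := (hv i).integrable_norm_rpow hp0
  have hj1 := (hv j).integrable_norm_rpow hp0
  have hij : Integrable (fun x => ‖(1 / 2 : ℝ) • (v i x + v j x)‖ ^ p) m :=
    (((hv i).add (hv j)).smul (1 / 2)).integrable_norm_rpow hp0
  have hle : ∫ x, ‖v i x - v j x‖ ^ p ∂m ≤ η * (∫ x, ‖v i x‖ ^ p ∂m + ∫ x, ‖v j x‖ ^ p ∂m)
      + C * ((∫ x, ‖v i x‖ ^ p ∂m + ∫ x, ‖v j x‖ ^ p ∂m) / 2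
        - ∫ x, ‖(1 / 2 : ℝ) • (v i x + v j x)‖ ^ p ∂m) := by
    have hs : Integrable (fun x => ‖v i x‖ ^ p + ‖v j x‖ ^ p) m := hi1.add hj1
    have hd : Integrable (fun x => (‖v i x‖ ^ p + ‖v j x‖ ^ p) / 2
      - ‖(1 / 2 : ℝ) • (v i x + v j x)‖ ^ p) m := (hs.div_const 2).sub hij
    rw [← integral_add hi1 hj1, ← integral_div, ← integral_sub (hs.div_const 2) hij,
      ← integral_const_mul, ← integral_const_mul,
      ← integral_add (hs.const_mul η) (hd.const_mul C)]
    exact integral_mono (((hv i).sub (hv j)).integrable_norm_rpow hp0)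
      ((hs.const_mul η).add (hd.const_mul C)) fun x => hconv (v i x) (v j x)
  have h1 : C * ((∫ x, ‖v i x‖ ^ p ∂m + ∫ x, ‖v j x‖ ^ p ∂m) / 2
      - ∫ x, ‖(1 / 2 : ℝ) • (v i x + v j x)‖ ^ p ∂m) < r ^ p / 2 := by
    rw [mul_comm, ← lt_div_iff₀ hC]
    exact hK i hi j hj
  have h2 : η * (∫ x, ‖v i x‖ ^ p ∂m + ∫ x, ‖v j x‖ ^ p ∂m) ≤ r ^ p / 2 := by
    rw [hη, div_mul_eq_mul_div, div_le_iff₀ (by positivity)]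
    have := hM i
    have := hM j
    exact mul_le_mul_of_nonneg_left (by linarith) (by positivity)
  have h3 : ∫ x, ‖v i x - v j x‖ ^ p ∂m < r ^ p := by linarith
  have h0 : 0 ≤ ∫ x, ‖v i x - v j x‖ ^ p ∂m := integral_nonneg fun x => by positivity
  refine lt_of_le_of_lt ?_ hr.2
  rw [secDist, eLpNorm_ofReal_eq hp0 ((hv i).memLp_norm_sub (hv j))]
  simp only [abs_norm]
  refine ENNReal.ofReal_le_ofReal ?_
  calc (∫ x, ‖v i x - v j x‖ ^ p ∂m) ^ (1 / p) ≤ (r ^ p) ^ (1 / p) :=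
        Real.rpow_le_rpow h0 h3.le (by positivity)
    _ = r := by rw [← Real.rpow_mul hr0, mul_one_div_cancel hp0.ne', Real.rpow_one]

/-- Lower semicontinuity of convex integrals along `L^q` convergence of sections, by Fatou's
lemma along an almost everywhere convergent subsequence. -/
theorem lintegral_le_of_tendsto {q : ℝ≥0∞} (hq : q ≠ 0) {v : ℕ → ∀ x, H x}
    (hv : ∀ n, v n ∈ F.sections) {w : ∀ x, H x} (hw : w ∈ F.sections)
    (h : Tendsto (fun n => secDist m q (v n) w) atTop (𝓝 0)) {f : ∀ x, H x → ℝ} {a : X → ℝ}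
    (hf : ∀ x, LowerSemicontinuous (f x)) (ha : AEMeasurable a m)
    (hfv : ∀ n, AEMeasurable (fun x => f x (v n x)) m) {j : ℝ≥0∞}
    (hj : Tendsto (fun n => ∫⁻ x, ENNReal.ofReal (f x (v n x) + a x) ∂m) atTop (𝓝 j)) :
    ∫⁻ x, ENNReal.ofReal (f x (w x) + a x) ∂m ≤ j := by
  obtain ⟨ns, hns, hae⟩ := exists_subseq_tendsto_ae hq hv hw h
  have hj' := hj.comp hns.tendsto_atTop
  rw [← hj'.liminf_eq]
  refine le_trans (lintegral_mono_ae ?_)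
    (lintegral_liminf_le' fun k => ((hfv (ns k)).add ha).ennreal_ofReal)
  filter_upwards [hae] with x hx
  have hlsc : LowerSemicontinuous fun y => ENNReal.ofReal (f x y + a x) :=
    Continuous.comp_lowerSemicontinuous (g := fun t : ℝ => ENNReal.ofReal (t + a x))
      (ENNReal.continuous_ofReal.comp (continuous_id.add continuous_const)) (hf x) fun s t hst => ENNReal.ofReal_le_ofReal (by linarith)
  exact (lowerSemicontinuousAt_iff_le_liminf.1 (hlsc (w x))).trans
    (liminf_le_liminf_of_le hx)

end

end MeasurableHilbertField

namespace VectorFieldBundle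

section

variable {X : Type*} [MetricSpace X] [LocallyCompactSpace X] [TopologicalSpace.SeparableSpace X]
  [MeasurableSpace X] [BorelSpace X]
  {m : Measure X} [IsFiniteMeasure m] {E : DirichletForm m}
  {A : NonUnitalSubalgebra ℝ C_c(X, ℝ)} {H : X → Type*}
  [∀ x, NormedAddCommGroup (H x)] [∀ x, InnerProductSpace ℝ (H x)]
  [∀ x, CompleteSpace (H x)] (B : VectorFieldBundle E A H)

open DirichletForm MeasurableHilbertField

theorem hasGradientOn_of_mem_affineClass (hA : E.BasicAssumption A) {p : ℝ} (hp : 1 < p)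
    (hAL : p < 2 → E.GeneratorAssumption A) {Ω : Set X} {g u : Lp ℝ (ENNReal.ofReal p) m}
    (hu : u ∈ E.affineClass A p Ω g) : B.HasGradientOn p Set.univ u (B.gradient p u) := by
  obtain ⟨v, hv⟩ := (B.mem_sobolev_iff hA hp).1 hu.1
  exact (hasGradientOn_gradient hA hp hAL hv).1

/-- Differences of elements of the affine class have zero boundary values on `Ω`. -/
theorem hasGradientOn_sub_of_mem_affineClass (hA : E.BasicAssumption A) {p : ℝ} (hp : 1 < p)
    (hAL : p < 2 → E.GeneratorAssumption A) {Ω : Set X} {g u u' : Lp ℝ (ENNReal.ofReal p) m}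
    (hu : u ∈ E.affineClass A p Ω g) (hu' : u' ∈ E.affineClass A p Ω g) :
    B.HasGradientOn p Ω (u - u') (B.gradient p u - B.gradient p u') := by
  have h := (B.hasGradientOn_of_mem_affineClass hA hp hAL hu).sub hA hp
    (B.hasGradientOn_of_mem_affineClass hA hp hAL hu')
  obtain ⟨-, φ, hφ, rfl⟩ := hu
  obtain ⟨-, φ', hφ', rfl⟩ := hu'
  obtain ⟨v, hv⟩ := (B.mem_sobolev_iff hA hp).1 hφ
  obtain ⟨v', hv'⟩ := (B.mem_sobolev_iff hA hp).1 hφ'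
  have h1 := hv.sub hA hp hv'
  rw [← add_sub_add_left_eq_sub φ φ' g] at h1
  exact h1.congr h.1.1 (h1.ae_eq hA hp hAL h)

theorem mem_affineClass_of_hasGradientOn (hA : E.BasicAssumption A) {p : ℝ} (hp : 1 < p)
    {Ω : Set X} {g u u' : Lp ℝ (ENNReal.ofReal p) m} (hu' : u' ∈ E.affineClass A p Ω g)
    {v : ∀ x, H x} (h : B.HasGradientOn p Ω (u - u') v) : u ∈ E.affineClass A p Ω g := by
  obtain ⟨h1, φ, hφ, hg⟩ := hu'
  obtain ⟨w, hw⟩ := (B.mem_sobolev_iff hA hp).1 h1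
  obtain ⟨w', hw'⟩ := (B.mem_sobolev_iff hA hp).1 hφ
  have h2 := (h.mono (Set.subset_univ _)).add hA hp hw
  rw [sub_add_cancel] at h2
  refine ⟨(B.mem_sobolev_iff hA hp).2 ⟨_, h2⟩, (u - u') + φ,
    (B.mem_sobolev_iff hA hp).2 ⟨_, h.add hA hp hw'⟩, ?_⟩
  rw [add_left_comm, ← hg, sub_add_cancel]

theorem midpoint_mem_affineClass (hA : E.BasicAssumption A) {p : ℝ} (hp : 1 < p)
    (hAL : p < 2 → E.GeneratorAssumption A) {Ω : Set X} {g u u' : Lp ℝ (ENNReal.ofReal p) m}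
    (hu : u ∈ E.affineClass A p Ω g) (hu' : u' ∈ E.affineClass A p Ω g) :
    (1 / 2 : ℝ) • (u + u') ∈ E.affineClass A p Ω g ∧
      ∀ᵐ x ∂m, B.gradient p ((1 / 2 : ℝ) • (u + u')) x
        = (1 / 2 : ℝ) • (B.gradient p u x + B.gradient p u' x) := by
  have hz := hasGradientOn_zero (B := B) hA p Ω
  have e : (1 / 2 : ℝ) • (u - u') + 0 = (1 / 2 : ℝ) • (u + u') - u' := by
    module
  have h1 := (B.hasGradientOn_sub_of_mem_affineClass hA hp hAL hu hu').smul_add hA hp (1 / 2) hz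
  rw [e] at h1
  refine ⟨B.mem_affineClass_of_hasGradientOn hA hp hu' h1, ?_⟩
  have h2 := ((B.hasGradientOn_of_mem_affineClass hA hp hAL hu).add hA hp
    (B.hasGradientOn_of_mem_affineClass hA hp hAL hu')).smul_add hA hp (1 / 2)
    (hasGradientOn_zero (B := B) hA p Set.univ)
  rw [add_zero, add_zero] at h2
  filter_upwards [(hasGradientOn_gradient hA hp hAL h2).2] with x hx
  rw [← hx]
  rfl

/-- Completeness of the affine class: if the gradients of a sequence are Cauchy in `L^p`, then by
the Poincaré inequality so are the functions, and the limit stays in the class. -/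
theorem exists_mem_affineClass_of_cauchy (hA : E.BasicAssumption A) {p : ℝ} (hp : 1 < p)
    (hAL : p < 2 → E.GeneratorAssumption A) {Ω : Set X} (hΩ : IsOpen Ω)
    (hP : E.Poincare A p Ω) {g : Lp ℝ (ENNReal.ofReal p) m} {u : ℕ → Lp ℝ (ENNReal.ofReal p) m}
    (hu : ∀ n, u n ∈ E.affineClass A p Ω g)
    (hc : ∀ ε : ℝ≥0∞, 0 < ε → ∃ N, ∀ i ≥ N, ∀ j ≥ N,
      secDist m (ENNReal.ofReal p) (B.gradient p (u i)) (B.gradient p (u j)) < ε) :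
    ∃ u₀ ∈ E.affineClass A p Ω g, Tendsto (fun n => secDist m (ENNReal.ofReal p)
      (B.gradient p (u n)) (B.gradient p u₀)) atTop (𝓝 0) := by
  have hq : 1 ≤ ENNReal.ofReal p := by simpa using hp.le
  have : Fact (1 ≤ ENNReal.ofReal p) := ⟨hq⟩
  have hgrad := fun n => B.hasGradientOn_of_mem_affineClass hA hp hAL (hu n)
  obtain ⟨v, hv, hlim⟩ := exists_tendsto_secDist hq (fun n => (hgrad n).1) hc
  obtain ⟨C, hC, hPC⟩ := B.exists_eLpNorm_le_of_poincare hA hp hAL hΩ hP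
  have hle : ∀ i j, edist (u i) (u j) ≤ C * secDist m (ENNReal.ofReal p)
      (B.gradient p (u i)) (B.gradient p (u j)) := fun i j => by
    rw [edist_eq_enorm_sub, Lp.enorm_def]
    exact hPC _ _ (B.hasGradientOn_sub_of_mem_affineClass hA hp hAL (hu i) (hu j))
  have hcu : CauchySeq u := by
    rw [EMetric.cauchySeq_iff]
    intro ε hε
    obtain ⟨N, hN⟩ := hc (ε / (C + 1)) (ENNReal.div_pos hε.ne' (by simp [hC]))
    refine ⟨N, fun i hi j hj => (hle i j).trans_lt ?_⟩
    have h1 := hN i hi j hj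
    rw [ENNReal.lt_div_iff_mul_lt (Or.inl (by simp)) (Or.inl (by simp [hC]))] at h1
    refine lt_of_le_of_lt ?_ h1
    rw [mul_comm]
    gcongr
    exact le_self_add
  obtain ⟨u₀, hu₀⟩ := cauchySeq_tendsto_of_complete hcu
  have h0 : B.HasGradientOn p Ω (u₀ - u 0) (v - B.gradient p (u 0)) := by
    refine HasGradientOn.of_tendsto hp
      (fun n => B.hasGradientOn_sub_of_mem_affineClass hA hp hAL (hu n) (hu 0))
      (hv.sub (hgrad 0).1)
      ((Lp.tendsto_Lp_iff_tendsto_eLpNorm' _ _).1 (hu₀.sub_const (u 0))) ?_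
    simpa only [secDist, Pi.sub_apply, sub_sub_sub_cancel_right] using hlim
  have hmem := B.mem_affineClass_of_hasGradientOn hA hp (hu 0) h0
  refine ⟨u₀, hmem, ?_⟩
  have h1 : B.HasGradientOn p Set.univ u₀ v := HasGradientOn.of_tendsto hp hgrad hv
    ((Lp.tendsto_Lp_iff_tendsto_eLpNorm' _ _).1 hu₀) hlim
  exact hlim.congr fun n => secDist_congr (ae_of_all _ fun _ => rfl)
    (hasGradientOn_gradient hA hp hAL h1).2

end

end VectorFieldBundle

end

theorem theorem5p1
    {X : Type*} [MetricSpace X] [LocallyCompactSpace X] [TopologicalSpace.SeparableSpace X]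
    [MeasurableSpace X] [BorelSpace X]
    (m : Measure X) [IsFiniteMeasure m] [m.IsOpenPosMeasure]
    (E : DirichletForm m) (A : NonUnitalSubalgebra ℝ C_c(X, ℝ)) (hA : E.BasicAssumption A)
    {H : X → Type*} [∀ x, NormedAddCommGroup (H x)] [∀ x, InnerProductSpace ℝ (H x)]
    [∀ x, CompleteSpace (H x)] (B : VectorFieldBundle E A H)
    (p : ℝ) (hp : 1 < p) (hAL : p < 2 → E.GeneratorAssumption A)
    (Ω : Set X) (hΩ : IsOpen Ω) (hPoincare : E.Poincare A p Ω)
    (f : ∀ x, H x → ℝ)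
    (hf_meas : ∀ v : ∀ x, H x, B.IsLpSection m (ENNReal.ofReal p) v →
      AEMeasurable (fun x => f x (v x)) m)
    (hf_lsc : ∀ x, LowerSemicontinuous (f x))
    (hf_convex : ∀ x, ConvexOn ℝ Set.univ (f x))
    (hf_coercive : ∃ (a : X → ℝ) (b : ℝ), Integrable a m ∧ 0 < b ∧
      ∀ v : ∀ x, H x, B.IsLpSection m (ENNReal.ofReal p) v →
        ∀ᵐ x ∂m, - a x + b * ‖v x‖ ^ p ≤ f x (v x))
    (g : Lp ℝ (ENNReal.ofReal p) m) (hg : g ∈ E.sobolev A p Set.univ) :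
    ∃ u₀ ∈ E.affineClass A p Ω g,
      B.functional p f u₀ = ⨅ u ∈ E.affineClass A p Ω g, B.functional p f u := by
  have hp0 : 0 < p := by linarith
  have hq0 : ENNReal.ofReal p ≠ 0 := by simpa using hp0
  obtain ⟨a, b, ha, hb, hcoer⟩ := hf_coercive
  have ham := ha.1.aemeasurable
  set S := E.affineClass A p Ω g with hS
  set J : Lp ℝ (ENNReal.ofReal p) m → ℝ≥0∞ := fun u =>
    ∫⁻ x, ENNReal.ofReal (f x (B.gradient p u x) + a x) ∂m with hJ
  have hL : ∀ u ∈ S, B.IsLpSection m (ENNReal.ofReal p) (B.gradient p u) := fun u hu =>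
    (B.hasGradientOn_of_mem_affineClass hA hp hAL hu).1
  have hmeas : ∀ u ∈ S, AEMeasurable (fun x => f x (B.gradient p u x)) m := fun u hu =>
    hf_meas _ (hL u hu)
  have hfun : ∀ u ∈ S, B.functional p f u = (J u : EReal) - ((∫ x, a x ∂m : ℝ) : EReal) := by
    intro u hu
    refine extIntegral_eq_lintegral_sub (hmeas u hu) ha ?_
    filter_upwards [hcoer _ (hL u hu)] with x hx
    have : 0 ≤ b * ‖B.gradient p u x‖ ^ p := by positivity
    linarith
  have hgS : g ∈ S := ⟨hg, 0, (B.mem_sobolev_iff hA hp).2 ⟨0, VectorFieldBundle.hasGradientOn_zero hA p Ω⟩,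
    (add_zero g).symm⟩
  -- it suffices to minimize `J`
  suffices h : ∃ u₀ ∈ S, ∀ u ∈ S, J u₀ ≤ J u by
    obtain ⟨u₀, hu₀, hmin⟩ := h
    refine ⟨u₀, hu₀, le_antisymm (le_iInf₂ fun u hu => ?_) (iInf₂_le u₀ hu₀)⟩
    rw [hfun u₀ hu₀, hfun u hu]
    exact EReal.sub_le_sub (EReal.coe_ennreal_le_coe_ennreal_iff.2 (hmin u hu)) le_rfl
  -- if `J` is identically infinite, every element is a minimizer
  by_cases hfin : ∃ u ∈ S, J u ≠ ∞
  swap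
  · push Not at hfin
    exact ⟨g, hgS, fun u hu => by rw [hfin u hu]; exact le_top⟩
  set N : Lp ℝ (ENNReal.ofReal p) m → ℝ := fun u => ∫ x, ‖B.gradient p u x‖ ^ p ∂m with hN
  obtain ⟨u, huS, hJlim, ⟨M, hM⟩, hdef⟩ := exists_minimizing_seq_midpoint
    (fun u u' => (1 / 2 : ℝ) • (u + u')) S J N
    (fun u hu u' hu' => (B.midpoint_mem_affineClass hA hp hAL hu hu').1)
    (by
      intro u hu u' hu'
      have h1 : J ((1 / 2 : ℝ) • (u + u')) ≤ 2⁻¹ * (J u + J u') := by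
        simp only [hJ]
        have hFm : AEMeasurable (fun x => ENNReal.ofReal (f x (B.gradient p u x) + a x)) m :=
          ((hmeas u hu).add ham).ennreal_ofReal
        rw [← lintegral_add_left' hFm,
          ← lintegral_const_mul' _ _ (by simp)]
        refine lintegral_mono_ae ?_
        filter_upwards [(B.midpoint_mem_affineClass hA hp hAL hu hu').2] with x hx
        have h2 := (hf_convex x).2 (Set.mem_univ (B.gradient p u x))
          (Set.mem_univ (B.gradient p u' x)) (show (0 : ℝ) ≤ 1 / 2 by norm_num)
          (show (0 : ℝ) ≤ 1 / 2 by norm_num) (by norm_num)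
        rw [← smul_add, ← hx] at h2
        simp only [smul_eq_mul] at h2
        calc ENNReal.ofReal (f x (B.gradient p ((1 / 2 : ℝ) • (u + u')) x) + a x)
            ≤ ENNReal.ofReal (2⁻¹ * ((f x (B.gradient p u x) + a x)
                + (f x (B.gradient p u' x) + a x))) :=
              ENNReal.ofReal_le_ofReal (by linarith)
          _ ≤ 2⁻¹ * (ENNReal.ofReal (f x (B.gradient p u x) + a x)
                + ENNReal.ofReal (f x (B.gradient p u' x) + a x)) := by
              rw [ENNReal.ofReal_mul (by norm_num), ENNReal.ofReal_inv_of_pos (by norm_num),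
                ENNReal.ofReal_ofNat]
              gcongr
              exact ENNReal.ofReal_add_le
      refine h1.trans ?_
      calc 2⁻¹ * (J u + J u') ≤ 2⁻¹ * (max (J u) (J u') + max (J u) (J u')) := by
            gcongr
            · exact le_max_left _ _
            · exact le_max_right _ _
        _ = max (J u) (J u') := by
            rw [← two_mul, ← mul_assoc, ENNReal.inv_mul_cancel (by simp) (by simp), one_mul])
    (fun u => integral_nonneg fun x => by positivity)
    (by
      intro t ht
      refine ⟨t.toReal / b, fun u hu hJt => ?_⟩
      have hint := (hL u hu).integrable_norm_rpow hp0
      rw [le_div_iff₀ hb, mul_comm]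
      have h1 : ENNReal.ofReal (b * N u) ≤ t := by
        refine le_trans ?_ hJt
        simp only [hN]
        rw [← integral_const_mul, ofReal_integral_eq_lintegral_ofReal (hint.const_mul b)
          (ae_of_all _ fun x => by positivity)]
        refine lintegral_mono_ae ?_
        filter_upwards [hcoer _ (hL u hu)] with x hx
        exact ENNReal.ofReal_le_ofReal (by linarith)
      exact (ENNReal.ofReal_le_iff_le_toReal ht).1 h1)
    hfin
  have hcauchy := MeasurableHilbertField.cauchy_of_midpoint_defect hp (fun n => hL _ (huS n)) hM (by
    intro ε hε
    obtain ⟨K, hK⟩ := hdef ε hε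
    refine ⟨K, fun i hi j hj => ?_⟩
    have h1 : N ((1 / 2 : ℝ) • (u i + u j)) = ∫ x, ‖(1 / 2 : ℝ) •
        (B.gradient p (u i) x + B.gradient p (u j) x)‖ ^ p ∂m := by
      refine integral_congr_ae ?_
      filter_upwards [(B.midpoint_mem_affineClass hA hp hAL (huS i) (huS j)).2] with x hx
      rw [hx]
    rw [← h1]
    exact hK i hi j hj)
  obtain ⟨u₀, hu₀, hlim⟩ :=
    B.exists_mem_affineClass_of_cauchy hA hp hAL hΩ hPoincare huS hcauchy
  refine ⟨u₀, hu₀, fun w hw => ?_⟩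
  exact (MeasurableHilbertField.lintegral_le_of_tendsto hq0 (fun n => (hL _ (huS n)).1) (hL _ hu₀).1 hlim hf_lsc ham
    (fun n => hmeas _ (huS n)) hJlim).trans (iInf₂_le w hw)
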